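/- Confidence level for $k$-qubit Pauli tomography. Let $k\ge 1$, $n\ge1$, $N=3^k n$, $0<\eta\le 1$, $\delta>0$, $d=2^k$. Let $\sigma_0=I$ and $\sigma_1,\sigma_2,\sigma_3$ be the Pauli matrices. For $i\in\{1,2,3\}$ let the one-qubit Pauli measurement with detection efficiency $\eta$ have outcomes $\pm1,0$ and POVM elements $\Pi^{\eta,(i)}_{\pm1}=\frac{\eta}{2}(I\pm\sigma_i)$, $\Pi^{\eta,(i)}_0=(1-\eta)I$. For $\boldsymbol i\in\{1,2,3\}^k$ and $\boldsymbol m\in\{1,-1,0\}^k$ put $\Pi^{(\boldsymbol i)}_{\boldsymbol m}=\bigotimes_{q}\Pi^{\eta,(i_q)}_{m_q}$, and for $\boldsymbol\beta\in\{0,1,2,3\}^k\setminus\{0\}$ put $\lambda_{\boldsymbol\beta}=2^{-(k-1)/2}\bigotimes_q\sigma_{\beta_q}$; let $l=l(\boldsymbol\beta)$ be the number of $q$ with $\beta_q=0$. For a Hermitian $\sigma$ of trace one let $p(\sigma)_{(\boldsymbol i,\boldsymbol m)}=\mathrm{Tr}[\Pi^{(\boldsymbol i)}_{\boldsymbol m}\sigma]$,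 let $s(\sigma)_{\boldsymbol\beta}=\mathrm{Tr}[\sigma\lambda_{\boldsymbol\beta}]$, and for a real vector $s$ let $\rho(s)=\frac1d I+\frac12\sum_{\boldsymbol\beta}s_{\boldsymbol\beta}\lambda_{\boldsymbol\beta}$. Let $(a_0)_{(\boldsymbol i,\boldsymbol m)}=\mathrm{Tr}[\Pi^{(\boldsymbol i)}_{\boldsymbol m}]/d$ and let $A$ be the real matrix with entries $A_{(\boldsymbol i,\boldsymbol m),\boldsymbol\beta}=\frac12\mathrm{Tr}[\Pi^{(\boldsymbol i)}_{\boldsymbol m}\lambda_{\boldsymbol\beta}]$. For a left inverse $L$ of $A$ put $$c_{\boldsymbol\beta}(L)=\sum_{\boldsymbol i}3^k\Big(\max_{\boldsymbol m}L_{\boldsymbol\beta,(\boldsymbol i,\boldsymbol m)}-\min_{\boldsymbol m}L_{\boldsymbol\beta,(\boldsymbol i,\boldsymbol m)}\Big)^2 .$$ Let $B$ be the matrix with $$B_{\boldsymbol\beta,(\boldsymbol i,\boldsymbol m)}=\frac{1}{\sqrt{2^{k-1}}}\,\frac1{\eta^{k-l}}\,\frac1{3^l}\prod_{q:\,\beta_q\ne0}m_q$$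 if $i_q=\beta_q$ for all $q$ with $\beta_q\neq0$, and $B_{\boldsymbol\beta,(\boldsymbol i,\boldsymbol m)}=0$ otherwise. (1) $BA=I$, and $s(\sigma)=B(p(\sigma)-a_0)$ for every Hermitian $\sigma$ of trace one. (2) For every $\boldsymbol\beta$, with $l=l(\boldsymbol\beta)$, $$c_{\boldsymbol\beta}(B)=\frac{2^{3-k}\,3^{k-l}}{\eta^{2(k-l)}} ,$$ and the same holds for $c_{\boldsymbol\beta}((A^TA)^{-1}A^T)$ if $\eta=1$ or $l=0$. (3) With the coefficient $b=16/(d(d^2-1))$ of the trace distance, the confidence level $1-2\sum_{\boldsymbol\beta}\exp[-\frac{b}{c_{\boldsymbol\beta}(B)}\delta^2N]$ equals $$CL(k)=1-2\sum_{l=0}^{k-1}3^{k-l}\binom kl\exp\Big[-\frac{2}{2^{2k}-1}\,\frac{\eta^{2(k-l)}}{3^{k-l}}\,\delta^2N\Big].$$ In particular $CL(1)=1-6e^{-\frac29\eta^2\delta^2N}$ and $CL(2)=1-18e^{-\frac2{135}\eta^4\delta^2N}-12e^{-\frac2{45}\eta^2\delta^2N}$. (4) For every real vector $f$ there is a unique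 minimiser $\sigma^{\mathrm{LLS}}(f)$ of $\|p(\sigma)-f\|_2$ over the Hermitian $\sigma$ of trace one, and there are unique density matrices $\rho^{\mathrm{ENM}}(f)$ and $\rho^{B}(f)$ that are nearest, in the Hilbert–Schmidt norm, to $\sigma^{\mathrm{LLS}}(f)$ and to $\rho(B(f-a_0))$, respectively. Let $\rho$ be any density matrix on $(\mathbb C^2)^{\otimes k}$, let each of the $3^k$ measurements be performed $n$ times on copies of $\rho$, all trials being independent, and let $f_N$ be the vector of relative frequencies of the outcomes. Then, for $\hat\rho=\rho^{\mathrm{ENM}}(f_N)$ as well as for $\hat\rho=\rho^{B}(f_N)$, $$\Pr\Big[\tfrac12\mathrm{Tr}\,|\hat\rho-\rho|\le\delta\Big]\ \ge\ CL(k).$$ -/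

import Mathlib

open scoped MatrixOrder ComplexOrder

noncomputable section

namespace PauliTomography

/-! ### Quantities of a general tomographic setting

`J` labels the measurements, `M` their outcomes, `α` the elements of the Hermitian basis and `D`
a basis of the Hilbert space. -/

section General

variable {D J M α : Type*}

/-- Density matrices: positive semidefinite with trace one. -/
def IsState [Fintype D] (ρ : Matrix D D ℂ) : Prop := ρ.PosSemidef ∧ ρ.trace = 1

/-- Born rule: the vector `p(σ)` with `(j, m)` entry `Tr[Π⁽ʲ⁾_m σ]` (a real number, as both matrices
are Hermitian). -/
def bornProb [Fintype D] (Pi : J → M → Matrix D D ℂ) (σ : Matrix D D ℂ) : J × M → ℝ :=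
  fun jm => (Pi jm.1 jm.2 * σ).trace.re

/-- The vector `a₀` with `(j, m)` entry `Tr[Π⁽ʲ⁾_m] / d`. -/
def povmOffset [Fintype D] (Pi : J → M → Matrix D D ℂ) : J × M → ℝ :=
  fun jm => (Pi jm.1 jm.2).trace.re / Fintype.card D

/-- The matrix `A` with `((j, m), α)` entry `Tr[Π⁽ʲ⁾_m λ_α] / 2`. -/
def designMatrix [Fintype D] (Pi : J → M → Matrix D D ℂ) (lam : α → Matrix D D ℂ) :
    Matrix (J × M) α ℝ :=
  Matrix.of fun jm a => (Pi jm.1 jm.2 * lam a).trace.re / 2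

/-- `(AᵀA)⁻¹Aᵀ`. -/
def lsInverse [Fintype J] [Fintype M] [Fintype α] [DecidableEq α]
    (A : Matrix (J × M) α ℝ) : Matrix α (J × M) ℝ :=
  (A.transpose * A)⁻¹ * A.transpose

/-- The Bloch vector `s_α = Tr[σ λ_α]`. -/
def blochVector [Fintype D] (lam : α → Matrix D D ℂ) (σ : Matrix D D ℂ) : α → ℝ :=
  fun a => (σ * lam a).trace.re

/-- The matrix `ρ(s) = I / d + (s · λ) / 2`. -/
def ofBloch [Fintype D] [DecidableEq D] [Fintype α] (lam : α → Matrix D D ℂ) (s : α → ℝ) :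
    Matrix D D ℂ :=
  (1 / (Fintype.card D : ℂ)) • (1 : Matrix D D ℂ) + (1 / 2 : ℂ) • ∑ a, (s a : ℂ) • lam a

/-- The constants `c_α = ∑ⱼ r⁽ʲ⁾ (max_m L_{α,(j,m)} - min_m L_{α,(j,m)})²` of a left inverse `L` of
the design matrix; `r⁽ʲ⁾` is the number of all trials over that of the trials of measurement `j`. -/
def settingConst [Fintype J] (r : J → ℝ) (L : Matrix α (J × M) ℝ) (a : α) : ℝ :=
  ∑ j, r j * ((⨆ m, L a (j, m)) - ⨅ m, L a (j, m)) ^ 2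

/-- `1 - 2 ∑_α exp(-(b / c_α) δ² N)`. -/
def confidenceLevel [Fintype α] (b : ℝ) (c : α → ℝ) (δ N : ℝ) : ℝ :=
  1 - 2 * ∑ a, Real.exp (-(b / c a * δ ^ 2 * N))

/-- The coefficient `b` of the trace distance in dimension `d`. -/
def traceDistCoeff (d : ℝ) : ℝ := 16 / (d * (d ^ 2 - 1))

/-- Hilbert–Schmidt norm `‖X‖₂ = Tr[X†X]^{1/2}`. -/
def hsNorm [Fintype D] (X : Matrix D D ℂ) : ℝ := Real.sqrt (X.conjTranspose * X).trace.re

/-- Trace distance `½ Tr|ρ' - ρ|`, with `|X| = (X†X)^{1/2}`. -/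
def traceDist [Fintype D] [DecidableEq D] (ρ' ρ : Matrix D D ℂ) : ℝ :=
  (1 / 2) * (CFC.abs (ρ' - ρ)).trace.re

/-- `σ` minimises `‖p(σ) - f‖₂` over the Hermitian matrices of trace one. -/
def IsLLS [Fintype D] [Fintype J] [Fintype M] (Pi : J → M → Matrix D D ℂ) (f : J × M → ℝ)
    (σ : Matrix D D ℂ) : Prop :=
  (σ.IsHermitian ∧ σ.trace = 1) ∧ ∀ τ : Matrix D D ℂ, τ.IsHermitian → τ.trace = 1 →
    ‖WithLp.toLp 2 (bornProb Pi σ - f)‖ ≤ ‖WithLp.toLp 2 (bornProb Pi τ - f)‖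

/-- `ρ` minimises `‖ρ - σ‖₂` over the density matrices. -/
def IsNearestState [Fintype D] (σ ρ : Matrix D D ℂ) : Prop :=
  IsState ρ ∧ ∀ τ : Matrix D D ℂ, IsState τ → hsNorm (ρ - σ) ≤ hsNorm (τ - σ)

/-- `ρ` is an extended norm-minimisation estimate for the relative frequencies `f`: a density
matrix nearest to the linear least squares estimate. -/
def IsENM [Fintype D] [Fintype J] [Fintype M] (Pi : J → M → Matrix D D ℂ) (f : J × M → ℝ)
    (ρ : Matrix D D ℂ) : Prop :=
  ∃ σ, IsLLS Pi f σ ∧ IsNearestState σ ρ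

/-- The same with the linear estimate `ρ(L (f - a₀))` given by a left inverse `L` of the
design matrix. -/
def IsENMWith [Fintype D] [DecidableEq D] [Fintype J] [Fintype M] [Fintype α]
    (Pi : J → M → Matrix D D ℂ) (lam : α → Matrix D D ℂ) (L : Matrix α (J × M) ℝ)
    (f : J × M → ℝ) (ρ : Matrix D D ℂ) : Prop :=
  IsNearestState (ofBloch lam (L.mulVec (f - povmOffset Pi))) ρ

/-- Relative frequencies of the outcomes, for `n` trials of each measurement. -/
def relFreq [DecidableEq M] {n : ℕ} (x : J → Fin n → M) : J × M → ℝ :=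
  fun jm => ((Finset.univ.filter fun q => x jm.1 q = jm.2).card : ℝ) / n

end General

/-! ### Pauli measurements on `k` qubits -/

/-- Bloch labels: strings of Pauli indices other than the all-identity string. -/
abbrev Label (k : ℕ) : Type := {β : Fin k → Fin 4 // β ≠ 0}

/-- Measurement settings: one of the three Pauli axes for each qubit. -/
abbrev Setting (k : ℕ) : Type := Fin k → Fin 3

/-- Outcomes `±1` or `0` (no detection) for each qubit. -/
abbrev Outcome (k : ℕ) : Type := Fin k → SignType

/-- `σ₀ = I` and the three Pauli matrices. -/
def pauli : Fin 4 → Matrix (Fin 2) (Fin 2) ℂ :=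
  ![1, !![0, 1; 1, 0], !![0, -Complex.I; Complex.I, 0], !![1, 0; 0, -1]]

/-- Tensor product of one-qubit matrices, in the computational basis of `(ℂ²)^{⊗k}`. -/
def tensor {k : ℕ} (X : Fin k → Matrix (Fin 2) (Fin 2) ℂ) :
    Matrix (Fin k → Fin 2) (Fin k → Fin 2) ℂ :=
  Matrix.of fun x y => ∏ q, X q (x q) (y q)

/-- One-qubit Pauli measurement along axis `i` with detection efficiency `η`. -/
def qubitPOVM (η : ℝ) (i : Fin 3) (m : SignType) : Matrix (Fin 2) (Fin 2) ℂ :=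
  if m = 0 then ((1 - η : ℝ) : ℂ) • 1
  else ((η / 2 : ℝ) : ℂ) • (1 + (m : ℂ) • pauli i.succ)

/-- Product Pauli measurement on `k` qubits. -/
def pauliPOVM (k : ℕ) (η : ℝ) (i : Setting k) (m : Outcome k) :
    Matrix (Fin k → Fin 2) (Fin k → Fin 2) ℂ :=
  tensor fun q => qubitPOVM η (i q) (m q)

/-- Normalised Pauli products `2^{-(k-1)/2} σ_{β₁} ⊗ ⋯ ⊗ σ_{β_k}`. -/
def pauliBasis (k : ℕ) (β : Label k) : Matrix (Fin k → Fin 2) (Fin k → Fin 2) ℂ :=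
  ((1 / Real.sqrt (2 ^ (k - 1)) : ℝ) : ℂ) • tensor fun q => pauli (β.1 q)

/-- The number `l` of identity factors. -/
def numId {k : ℕ} (β : Label k) : ℕ := (Finset.univ.filter fun q => β.1 q = 0).card

/-- The matrix `B` that averages, over all settings which agree with `β` on its non-identity
factors, the product of the corresponding outcomes rescaled by the detection efficiency. -/
def pauliInverse (k : ℕ) (η : ℝ) : Matrix (Label k) (Setting k × Outcome k) ℝ :=
  Matrix.of fun β im =>
    if ∀ q, β.1 q ≠ 0 → (im.1 q).succ = β.1 q then
      1 / Real.sqrt (2 ^ (k - 1)) * (1 / η ^ (k - numId β)) * (1 / 3 ^ numId β) *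
        ∏ q ∈ Finset.univ.filter (fun q => β.1 q ≠ 0), ((im.2 q : SignType) : ℝ)
    else 0

/-- The value `2^{3-k} 3^{k-l} / η^{2(k-l)}`. -/
def pauliConst (k : ℕ) (η : ℝ) (l : ℕ) : ℝ :=
  (2 : ℝ) ^ (3 - (k : ℤ)) * 3 ^ (k - l) / η ^ (2 * (k - l))

/-- `CL(k)`. -/
def pauliCL (k : ℕ) (η δ N : ℝ) : ℝ :=
  1 - 2 * ∑ l ∈ Finset.range k, 3 ^ (k - l) * (k.choose l : ℝ) *
    Real.exp (-(2 / (2 ^ (2 * k) - 1) * (η ^ (2 * (k - l)) / 3 ^ (k - l)) * δ ^ 2 * N))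

/-- The outcomes `X i q` (`q`-th trial of setting `i`) of independent measurements, `n` for each
setting, on copies of the state `ρ`. -/
structure IsExperiment {Ω : Type*} [MeasurableSpace Ω] (μ : MeasureTheory.Measure Ω)
    (k n : ℕ) (η : ℝ) (ρ : Matrix (Fin k → Fin 2) (Fin k → Fin 2) ℂ)
    (X : Setting k → Fin n → Ω → Outcome k) : Prop where
  measurable : ∀ i q, @Measurable Ω (Outcome k) _ ⊤ (X i q)
  indep : ProbabilityTheory.iIndepFun (m := fun _ => ⊤)
    (fun iq : Setting k × Fin n => X iq.1 iq.2) μ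
  law : ∀ i q m, μ.real {ω | X i q ω = m} = bornProb (pauliPOVM k η) ρ (i, m)

end PauliTomography

end

noncomputable section

namespace PauliTomography

/-! ### Pauli matrices and their tensor products -/

/-! Everything factorises over the qubits. The trace of a product POVM element against a Pauli
string is a product of one-qubit responses, so sums over settings and outcomes are products of
one-qubit sums, and distinct labels give orthogonal products (`sum_siteProd_mul`). This yields `BA =
I` and a diagonal `AᵀA`; the rows of `B` and of `(AᵀA)⁻¹Aᵀ` are both multiples of a `siteProd`, with
weights `1` and `Tr Π_m` on the identity sites. Such a product has a symmetric range on the `3^l`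
settings compatible with the label and vanishes on the others, which gives the constants
(`settingConst_siteProd`).

For a left inverse `L`, `s(ρ) = L (p - a₀)`, so each coordinate error of the linear estimate is a
centred sum over independent trials and obeys Hoeffding's inequality. Projection onto the convex set
of states does not increase the distance to `ρ`, and `(½ Tr|X|)² ≤ (d/4)‖X‖₂²`, where `‖X‖₂²` is
half the squared Bloch distance. Hence coordinate errors below thresholds with `∑ ε_β² ≤ 8δ²/d`
force trace distance at most `δ`; a union bound gives `confidence_of_thresholds`.

Equal thresholds settle `B`. For least squares with `η < 1` the constants of labels with `l ≥ 1` can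
exceed those of `B`; only `c_β ≤ c₀ / 3^l` is used, `c₀` being the common constant at `l = 0`.
Either `CL(k) ≤ 0`, or moving part of the threshold budget from `l ≥ 1` to `l = 0` brings the total
failure bound below the `l = 0` term of `CL(k)` alone (`threshold_sum_le`). -/

/-- `Tr[Π⁽ⁱ⁾_m σ_b]` for one qubit. -/
def response (η : ℝ) (i : Fin 3) (m : SignType) (b : Fin 4) : ℝ :=
  if b = 0 then (if m = 0 then 2 * (1 - η) else η) else if i.succ = b then η * (m : ℝ) else 0

lemma trace_qubitPOVM_mul_pauli (η : ℝ) (i : Fin 3) (m : SignType) (b : Fin 4) :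
    (qubitPOVM η i m * pauli b).trace = (response η i m b : ℂ) := by
  fin_cases i <;> cases m <;> fin_cases b <;>
    simp [qubitPOVM, pauli, response, Matrix.trace_fin_two, Matrix.mul_apply, Fin.sum_univ_two,
      Matrix.one_apply, Fin.ext_iff] <;> ring_nf <;> simp [Complex.I_sq]

lemma isHermitian_pauli (b : Fin 4) : (pauli b).IsHermitian := by
  ext x y
  fin_cases b <;> fin_cases x <;> fin_cases y <;> simp [pauli]

lemma trace_pauli_mul_pauli (b c : Fin 4) :
    (pauli b * pauli c).trace = if b = c then 2 else 0 := by
  fin_cases b <;> fin_cases c <;>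
    simp [pauli, Matrix.trace_fin_two] <;> norm_num

lemma sum_pauli_mul_pauli (u v a b : Fin 2) :
    ∑ c, pauli c u v * pauli c a b = if u = b ∧ v = a then 2 else 0 := by
  fin_cases u <;> fin_cases v <;> fin_cases a <;> fin_cases b <;>
    simp [pauli, Fin.sum_univ_four] <;> norm_num

variable {k : ℕ}

lemma tensor_mul (X Y : Fin k → Matrix (Fin 2) (Fin 2) ℂ) :
    tensor X * tensor Y = tensor fun q => X q * Y q := by
  ext x y
  simp only [tensor, Matrix.mul_apply, Matrix.of_apply, ← Finset.prod_mul_distrib]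
  rw [Finset.prod_univ_sum, Fintype.piFinset_univ]

lemma trace_tensor (X : Fin k → Matrix (Fin 2) (Fin 2) ℂ) :
    (tensor X).trace = ∏ q, (X q).trace := by
  simp only [tensor, Matrix.trace, Matrix.diag_apply, Matrix.of_apply]
  rw [Finset.prod_univ_sum, Fintype.piFinset_univ]

lemma tensor_one : tensor (fun _ : Fin k => 1) = 1 := by
  ext x y
  simp only [tensor, Matrix.of_apply, Matrix.one_apply, Finset.prod_ite_zero, Finset.prod_const_one,
    Finset.mem_univ, true_imp_iff, funext_iff]

/-- The unnormalised Pauli string `σ_{β₁} ⊗ ⋯ ⊗ σ_{β_k}`. -/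
def pauliString (β : Fin k → Fin 4) : Matrix (Fin k → Fin 2) (Fin k → Fin 2) ℂ :=
  tensor fun q => pauli (β q)

/-- The normalisation `2^{-(k-1)/2}` of the Pauli basis. -/
def normCoeff (k : ℕ) : ℝ := 1 / Real.sqrt (2 ^ (k - 1))

lemma normCoeff_pos (k : ℕ) : 0 < normCoeff k := by unfold normCoeff; positivity

lemma normCoeff_sq (hk : 1 ≤ k) : normCoeff k ^ 2 * 2 ^ k = 2 := by
  obtain ⟨j, rfl⟩ := Nat.exists_eq_add_of_le' hk
  rw [normCoeff, div_pow, Real.sq_sqrt (by positivity), Nat.add_sub_cancel, pow_succ]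
  field_simp
  rw [pow_succ]

lemma pauliBasis_eq (β : Label k) : pauliBasis k β = (normCoeff k : ℂ) • pauliString β.1 := rfl

lemma pauliString_zero : pauliString (0 : Fin k → Fin 4) = 1 := by
  have : pauli 0 = 1 := rfl
  simp [pauliString, this, tensor_one]

lemma isHermitian_pauliString (β : Fin k → Fin 4) : (pauliString β).IsHermitian := by
  ext x y
  simp only [pauliString, tensor, Matrix.conjTranspose_apply, Matrix.of_apply, star_prod]
  exact Finset.prod_congr rfl fun q _ => (isHermitian_pauli (β q)).apply _ _

lemma trace_pauliString_mul (β γ : Fin k → Fin 4) :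
    (pauliString β * pauliString γ).trace = if β = γ then 2 ^ k else 0 := by
  simp only [pauliString, tensor_mul, trace_tensor, trace_pauli_mul_pauli, Finset.prod_ite_zero,
    Finset.prod_const, Finset.mem_univ, true_imp_iff, funext_iff, Finset.card_univ,
    Fintype.card_fin]

lemma sum_pauliString_mul (x y a b : Fin k → Fin 2) :
    ∑ β, pauliString β x y * pauliString β a b = if x = b ∧ y = a then 2 ^ k else 0 := by
  simp only [pauliString, tensor, Matrix.of_apply, ← Finset.prod_mul_distrib]
  have := Finset.prod_univ_sum (fun _ : Fin k => (Finset.univ : Finset (Fin 4)))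
    (fun q c => pauli c (x q) (y q) * pauli c (a q) (b q))
  rw [Fintype.piFinset_univ] at this
  rw [← this]
  simp only [sum_pauli_mul_pauli, Finset.prod_ite_zero, Finset.prod_const, Finset.mem_univ,
    true_imp_iff, funext_iff, Finset.card_univ, Fintype.card_fin, forall_and]

/-- Completeness of the Pauli strings: on one qubit `∑ σ_c ⊗ σ_c` is twice the swap, and this
relation tensorises. No dimension count is needed. -/
lemma sum_trace_mul_pauliString (M : Matrix (Fin k → Fin 2) (Fin k → Fin 2) ℂ) :
    ∑ β, (M * pauliString β).trace • pauliString β = (2 ^ k : ℂ) • M := by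
  ext a b
  simp only [Matrix.sum_apply, Matrix.smul_apply, smul_eq_mul, Matrix.trace, Matrix.diag_apply,
    Matrix.mul_apply, Finset.sum_mul, mul_assoc]
  rw [Finset.sum_comm]
  simp_rw [Finset.sum_comm (s := (Finset.univ : Finset (Fin k → Fin 4))), ← Finset.mul_sum,
    sum_pauliString_mul]
  simp only [ite_and, mul_ite, mul_zero]
  simp [mul_comm]

/-- Splitting off the all-identity string. -/
lemma sum_strings {E : Type*} [AddCommMonoid E] (g : (Fin k → Fin 4) → E) :
    ∑ β, g β = g 0 + ∑ β : Label k, g β.1 := by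
  rw [← Finset.add_sum_erase _ _ (Finset.mem_univ (0 : Fin k → Fin 4))]
  congr 1
  exact (Finset.sum_subtype _ (by simp) g)

/-! ### The Pauli basis and Bloch vectors -/

lemma isHermitian_pauliBasis (β : Label k) : (pauliBasis k β).IsHermitian := by
  rw [pauliBasis_eq, Matrix.IsHermitian, Matrix.conjTranspose_smul,
    (isHermitian_pauliString β.1).eq]
  simp

lemma trace_pauliBasis (β : Label k) : (pauliBasis k β).trace = 0 := by
  have := trace_pauliString_mul β.1 0
  rw [pauliString_zero, mul_one, if_neg β.2] at this
  rw [pauliBasis_eq, Matrix.trace_smul, this, smul_zero]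

lemma trace_pauliBasis_mul (hk : 1 ≤ k) (β γ : Label k) :
    (pauliBasis k β * pauliBasis k γ).trace = if β = γ then 2 else 0 := by
  simp only [pauliBasis_eq, smul_mul_smul_comm, Matrix.trace_smul, trace_pauliString_mul,
    Subtype.ext_iff, smul_eq_mul, mul_ite, mul_zero]
  have := normCoeff_sq hk
  congr 1
  rw [← sq]
  exact_mod_cast this

lemma isHermitian_ofBloch (s : Label k → ℝ) : (ofBloch (pauliBasis k) s).IsHermitian := by
  simp only [ofBloch, Matrix.IsHermitian, Matrix.conjTranspose_add, Matrix.conjTranspose_smul,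
    Matrix.conjTranspose_one, Matrix.conjTranspose_sum, (isHermitian_pauliBasis _).eq]
  simp

lemma trace_ofBloch (s : Label k → ℝ) : (ofBloch (pauliBasis k) s).trace = 1 := by
  simp [ofBloch, Matrix.trace_add, Matrix.trace_smul, Matrix.trace_sum, trace_pauliBasis]

lemma trace_mul_re_of_isHermitian {D : Type*} [Fintype D] {X Y : Matrix D D ℂ}
    (hX : X.IsHermitian) (hY : Y.IsHermitian) : ((X * Y).trace.re : ℂ) = (X * Y).trace := by
  apply Complex.conj_eq_iff_re.1
  rw [starRingEnd_apply, ← Matrix.trace_conjTranspose, Matrix.conjTranspose_mul, hX.eq, hY.eq,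
    Matrix.trace_mul_comm]

lemma ofBloch_blochVector (hk : 1 ≤ k) {σ : Matrix (Fin k → Fin 2) (Fin k → Fin 2) ℂ}
    (hσ : σ.IsHermitian) (htr : σ.trace = 1) :
    ofBloch (pauliBasis k) (blochVector (pauliBasis k) σ) = σ := by
  have h := sum_trace_mul_pauliString σ
  rw [sum_strings, pauliString_zero, mul_one, htr, one_smul] at h
  have h2 : σ = (1 / 2 ^ k : ℂ) • (1 + ∑ β : Label k, (σ * pauliString β.1).trace • pauliString β.1)
      := by rw [h, smul_smul]; simp
  conv_rhs => rw [h2]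
  have hn : (normCoeff k : ℂ) ^ 2 * 2 ^ k = 2 := by exact_mod_cast normCoeff_sq hk
  simp only [ofBloch, blochVector, trace_mul_re_of_isHermitian hσ (isHermitian_pauliBasis _),
    smul_add, Finset.smul_sum, smul_smul, Fintype.card_fun, Fintype.card_fin]
  congr 1
  · simp
  · refine Finset.sum_congr rfl fun β _ => ?_
    rw [pauliBasis_eq, Matrix.mul_smul, Matrix.trace_smul, smul_smul, smul_eq_mul]
    congr 1
    field_simp
    linear_combination (σ * pauliString β.1).trace * hn

/-- The factor `1/2` under the root is `(1/2)²` from `ρ(s)` times `Tr λ_β² = 2`. -/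
lemma hsNorm_ofBloch_sub (hk : 1 ≤ k) (s t : Label k → ℝ) :
    hsNorm (ofBloch (pauliBasis k) s - ofBloch (pauliBasis k) t) =
      Real.sqrt (1 / 2) * ‖WithLp.toLp 2 (s - t)‖ := by
  have hX : ofBloch (pauliBasis k) s - ofBloch (pauliBasis k) t =
      (1 / 2 : ℂ) • ∑ β, ((s - t) β : ℂ) • pauliBasis k β := by
    simp [ofBloch, sub_smul, Finset.sum_sub_distrib, smul_sub]
  rw [hsNorm, EuclideanSpace.norm_eq, ← Real.sqrt_mul (by norm_num)]
  congr 1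
  rw [Matrix.conjTranspose_sub, (isHermitian_ofBloch s).eq, (isHermitian_ofBloch t).eq, hX]
  simp only [smul_mul_smul_comm, Matrix.sum_mul, Matrix.mul_sum, Matrix.trace_smul,
    Matrix.trace_sum, trace_pauliBasis_mul hk]
  simp only [smul_eq_mul, mul_ite, mul_zero, Finset.sum_ite_eq', Finset.mem_univ, if_true,
    ← Finset.sum_mul, Real.norm_eq_abs, sq_abs]
  rw [show (1 / 2 * (1 / 2) * ((∑ i, ((s - t) i : ℂ) * ((s - t) i : ℂ)) * 2) : ℂ) =
    ((1 / 2 * ∑ i, (s - t) i ^ 2 : ℝ) : ℂ) by push_cast; simp only [sq]; ring, Complex.ofReal_re]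

/-! ### Matrices that factorise over the qubits -/

/-- Factor of a product matrix at one qubit: the outcome `m` if the measured axis is the Pauli label
`b`, and the weight `v m` if `b` is the identity. -/
def siteFactor (v : SignType → ℝ) (b : Fin 4) (i : Fin 3) (m : SignType) : ℝ :=
  if b = 0 then v m else if i.succ = b then (m : ℝ) else 0

/-- Product of the one-qubit factors. -/
def siteProd (v : SignType → ℝ) (β : Fin k → Fin 4) (i : Setting k) (m : Outcome k) : ℝ :=
  ∏ q, siteFactor v (β q) (i q) (m q)

/-- `Tr Π_m` for one qubit. -/
def outcomeWeight (η : ℝ) (m : SignType) : ℝ := if m = 0 then 2 * (1 - η) else η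

lemma response_eq (η : ℝ) (i : Fin 3) (m : SignType) (b : Fin 4) :
    response η i m b = (if b = 0 then 1 else η) * siteFactor (outcomeWeight η) b i m := by
  unfold response siteFactor outcomeWeight
  split_ifs <;> simp

lemma card_filter_ne_zero (β : Label k) :
    (Finset.univ.filter fun q => ¬ β.1 q = 0).card = k - numId β := by
  have := Finset.card_filter_add_card_filter_not (s := (Finset.univ : Finset (Fin k)))
    (fun q => β.1 q = 0)
  simp only [Finset.card_univ, Fintype.card_fin] at this
  unfold numId
  omega

lemma numId_lt (β : Label k) : numId β < k := by
  obtain ⟨q, hq⟩ := Function.ne_iff.1 β.2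
  have : (Finset.univ.filter fun q => ¬ β.1 q = 0).Nonempty := ⟨q, by simpa using hq⟩
  have := this.card_pos
  rw [card_filter_ne_zero] at this
  omega

lemma prod_label_ite (β : Label k) (a b : ℝ) :
    ∏ q, (if β.1 q = 0 then a else b) = a ^ numId β * b ^ (k - numId β) := by
  rw [Finset.prod_ite, Finset.prod_const, Finset.prod_const, card_filter_ne_zero, numId]

lemma prod_response (η : ℝ) (β : Label k) (i : Setting k) (m : Outcome k) :
    ∏ q, response η (i q) (m q) (β.1 q) =
      η ^ (k - numId β) * siteProd (outcomeWeight η) β.1 i m := by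
  simp only [response_eq, Finset.prod_mul_distrib, prod_label_ite, one_pow, one_mul, siteProd]

lemma designMatrix_apply (η : ℝ) (β : Label k) (im : Setting k × Outcome k) :
    designMatrix (pauliPOVM k η) (pauliBasis k) im β =
      normCoeff k / 2 * η ^ (k - numId β) * siteProd (outcomeWeight η) β.1 im.1 im.2 := by
  have : (pauliPOVM k η im.1 im.2 * pauliBasis k β).trace =
      ((normCoeff k * ∏ q, response η (im.1 q) (im.2 q) (β.1 q) : ℝ) : ℂ) := by
    rw [pauliBasis_eq, Matrix.mul_smul, Matrix.trace_smul, pauliPOVM, pauliString, tensor_mul,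
      trace_tensor]
    simp only [trace_qubitPOVM_mul_pauli]
    push_cast
    rfl
  rw [designMatrix, Matrix.of_apply, this, Complex.ofReal_re, prod_response]
  ring

/-- The compatibility condition in `B` is absorbed by site factors that vanish on a wrong axis. -/
lemma pauliInverse_apply (η : ℝ) (β : Label k) (im : Setting k × Outcome k) :
    pauliInverse k η β im =
      normCoeff k * (1 / η ^ (k - numId β)) * (1 / 3 ^ numId β) *
        siteProd (fun _ => 1) β.1 im.1 im.2 := by
  have : siteProd (fun _ => 1) β.1 im.1 im.2 =
      if ∀ q, β.1 q ≠ 0 → (im.1 q).succ = β.1 q then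
        ∏ q ∈ Finset.univ.filter (fun q => β.1 q ≠ 0), ((im.2 q : SignType) : ℝ) else 0 := by
    split_ifs with h
    · rw [Finset.prod_filter, siteProd]
      refine Finset.prod_congr rfl fun q _ => ?_
      by_cases hq : β.1 q = 0
      · simp [siteFactor, hq]
      · simp [siteFactor, hq, h q hq]
    · push Not at h
      obtain ⟨q, h1, h2⟩ := h
      exact Finset.prod_eq_zero (Finset.mem_univ q) (by simp [siteFactor, h1, h2])
  rw [this, pauliInverse, Matrix.of_apply, mul_ite, mul_zero]
  rfl

lemma sum_signType (f : SignType → ℝ) : ∑ m, f m = f 0 + f (-1) + f 1 := by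
  rw [show (Finset.univ : Finset SignType) = {0, -1, 1} from rfl, Finset.sum_insert (by decide),
    Finset.sum_pair (by decide), add_assoc]

/-- Even weights are orthogonal to the odd outcome `m`, and different axes have disjoint supports.
On the diagonal, an identity site sums over three axes, a Pauli site over one axis with `m² = 1`
twice. -/
lemma sum_siteFactor_mul {v w : SignType → ℝ} (hv : v (-1) = v 1) (hw : w (-1) = w 1)
    (b c : Fin 4) :
    ∑ im : Fin 3 × SignType, siteFactor v b im.1 im.2 * siteFactor w c im.1 im.2 =
      if b = c then (if b = 0 then 3 * ∑ m, v m * w m else 2) else 0 := by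
  rw [Fintype.sum_prod_type]
  simp only [sum_signType, Fin.sum_univ_three]
  fin_cases b <;> fin_cases c <;> simp [siteFactor, hv, hw, Fin.ext_iff] <;> ring

lemma sum_siteProd_mul {v w : SignType → ℝ} (hv : v (-1) = v 1) (hw : w (-1) = w 1)
    (β γ : Label k) :
    ∑ im : Setting k × Outcome k, siteProd v β.1 im.1 im.2 * siteProd w γ.1 im.1 im.2 =
      if β = γ then (3 * ∑ m, v m * w m) ^ numId β * 2 ^ (k - numId β) else 0 := by
  have h := Finset.prod_univ_sum (fun _ : Fin k => (Finset.univ : Finset (Fin 3 × SignType)))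
    (fun q im => siteFactor v (β.1 q) im.1 im.2 * siteFactor w (γ.1 q) im.1 im.2)
  rw [Fintype.piFinset_univ] at h
  simp only [sum_siteFactor_mul hv hw, Finset.prod_ite_zero, prod_label_ite, Finset.mem_univ,
    true_imp_iff] at h
  simp only [siteProd, ← Finset.prod_mul_distrib, Subtype.ext_iff, funext_iff]
  rw [h]
  exact (Equiv.sum_comp (Equiv.arrowProdEquivProdArrow (Fin k) (fun _ => Fin 3)
    (fun _ => SignType)) _).symm

lemma pauliInverse_mul_designMatrix (hk : 1 ≤ k) {η : ℝ} (hη : 0 < η) :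
    pauliInverse k η * designMatrix (pauliPOVM k η) (pauliBasis k) = 1 := by
  ext β γ
  simp only [Matrix.mul_apply, pauliInverse_apply, designMatrix_apply, mul_mul_mul_comm _
    (siteProd _ _ _ _) _ (siteProd _ _ _ _), ← Finset.mul_sum]
  rw [sum_siteProd_mul rfl (by simp [outcomeWeight]), Matrix.one_apply]
  split_ifs with h
  · subst h
    have h2 : (2 : ℝ) ^ k = 2 ^ numId β * 2 ^ (k - numId β) := by
      rw [← pow_add, Nat.add_sub_of_le (numId_lt β).le]
    -- The outcome weights sum to `Tr I = 2` for every `η`.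
    have hS : (3 : ℝ) * ∑ m, 1 * outcomeWeight η m = 3 * 2 := by
      simp [sum_signType, outcomeWeight]; ring
    have hn := normCoeff_sq hk
    rw [h2] at hn
    rw [hS, mul_pow]
    field_simp
    linear_combination hn
  · simp

/-- The squared norm of the weights of a qubit that carries an identity label. -/
def weightSq (η : ℝ) : ℝ := 2 * η ^ 2 + 4 * (1 - η) ^ 2

lemma weightSq_pos {η : ℝ} (hη : 0 < η) : 0 < weightSq η := by
  unfold weightSq; positivity

/-- The columns of `A` are orthogonal, so each row of the least squares inverse is a rescaled column
of `A`. -/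
lemma lsInverse_apply (hk : 1 ≤ k) {η : ℝ} (hη : 0 < η) (β : Label k)
    (im : Setting k × Outcome k) :
    lsInverse (designMatrix (pauliPOVM k η) (pauliBasis k)) β im =
      normCoeff k * 2 ^ numId β / (η ^ (k - numId β) * (3 * weightSq η) ^ numId β) *
        siteProd (outcomeWeight η) β.1 im.1 im.2 := by
  set A := designMatrix (pauliPOVM k η) (pauliBasis k) with hA
  have hn0 := normCoeff_pos k
  have hS := weightSq_pos hη
  have hgram : A.transpose * A = Matrix.diagonal fun β : Label k =>
      normCoeff k ^ 2 / 4 * η ^ (2 * (k - numId β)) *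
        ((3 * weightSq η) ^ numId β * 2 ^ (k - numId β)) := by
    ext β γ
    simp only [Matrix.mul_apply, Matrix.transpose_apply, hA, designMatrix_apply, mul_mul_mul_comm _
      (siteProd _ _ _ _) _ (siteProd _ _ _ _), ← Finset.mul_sum]
    rw [sum_siteProd_mul (by simp [outcomeWeight]) (by simp [outcomeWeight]),
      Matrix.diagonal_apply]
    split_ifs with h
    · subst h
      have : ∑ m, outcomeWeight η m * outcomeWeight η m = weightSq η := by
        simp [sum_signType, outcomeWeight, weightSq]; ring
      rw [this, two_mul, pow_add]
      ring
    · simp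
  have hinv : (A.transpose * A)⁻¹ = Matrix.diagonal fun β : Label k =>
      (normCoeff k ^ 2 / 4 * η ^ (2 * (k - numId β)) *
        ((3 * weightSq η) ^ numId β * 2 ^ (k - numId β)))⁻¹ := by
    refine Matrix.inv_eq_left_inv ?_
    rw [hgram, Matrix.diagonal_mul_diagonal, ← Matrix.diagonal_one]
    congr 1
    ext β
    exact inv_mul_cancel₀ (by positivity)
  rw [lsInverse, hinv, Matrix.diagonal_mul, Matrix.transpose_apply, hA, designMatrix_apply,
    ← mul_assoc]
  congr 1
  have h2 : (2 : ℝ) ^ k = 2 ^ numId β * 2 ^ (k - numId β) := by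
    rw [← pow_add, Nat.add_sub_of_le (numId_lt β).le]
  have hn := normCoeff_sq hk
  rw [h2] at hn
  rw [mul_comm 2 (k - numId β), pow_mul]
  field_simp
  linear_combination (-2 : ℝ) * hn

/-! ### The constants of product matrices -/

lemma abs_siteFactor_le {v : SignType → ℝ} {V : ℝ} (hV : ∀ m, |v m| ≤ V) (b : Fin 4) (i : Fin 3)
    (m : SignType) : |siteFactor v b i m| ≤ if b = 0 then V else 1 := by
  unfold siteFactor
  split_ifs
  · exact hV m
  · cases m <;> simp
  · simp

lemma abs_siteProd_le {v : SignType → ℝ} {V : ℝ} (hV : ∀ m, |v m| ≤ V) (β : Label k)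
    (i : Setting k) (m : Outcome k) : |siteProd v β.1 i m| ≤ V ^ numId β := by
  rw [siteProd, Finset.abs_prod]
  refine (Finset.prod_le_prod (fun _ _ => abs_nonneg _)
    fun q _ => abs_siteFactor_le hV (β.1 q) (i q) (m q)).trans_eq ?_
  rw [prod_label_ite, one_pow, mul_one]

/-- The sign is reversed by flipping the outcome at one non-identity site, which exists because `β ≠
0`. -/
lemma exists_siteProd_eq {v : SignType → ℝ} (m₀ : SignType) (β : Label k) {i : Setting k}
    (hi : ∀ q, β.1 q ≠ 0 → (i q).succ = β.1 q) :
    (∃ m, siteProd v β.1 i m = v m₀ ^ numId β) ∧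
      ∃ m, siteProd v β.1 i m = -v m₀ ^ numId β := by
  have key : ∏ q, (if β.1 q = 0 then v m₀ else 1) = v m₀ ^ numId β := by
    rw [prod_label_ite, one_pow, mul_one]
  obtain ⟨q₀, hq₀⟩ := Function.ne_iff.1 β.2
  refine ⟨⟨fun q => if β.1 q = 0 then m₀ else 1, ?_⟩,
    ⟨fun q => if β.1 q = 0 then m₀ else if q = q₀ then -1 else 1, ?_⟩⟩
  · rw [← key]
    refine Finset.prod_congr rfl fun q _ => ?_
    by_cases hq : β.1 q = 0
    · simp [siteFactor, hq]
    · simp [siteFactor, hq, hi q hq]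
  · have : -v m₀ ^ numId β =
        ∏ q, (if q = q₀ then -1 else 1) * (if β.1 q = 0 then v m₀ else 1) := by
      rw [Finset.prod_mul_distrib, key, Finset.prod_ite_eq']
      simp
    rw [this]
    refine Finset.prod_congr rfl fun q _ => ?_
    by_cases hq : β.1 q = 0
    · have hne : q ≠ q₀ := by rintro rfl; exact hq₀ hq
      simp [siteFactor, hq, hne]
    · by_cases h : q = q₀
      · subst h; simp [siteFactor, hq, hi q hq]
      · simp [siteFactor, hq, hi q hq, h]

lemma sum_agree (β : Label k) :
    ∑ i : Setting k, (if ∀ q, β.1 q ≠ 0 → (i q).succ = β.1 q then (1 : ℝ) else 0) =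
      3 ^ numId β := by
  have h := Finset.prod_univ_sum (fun _ : Fin k => (Finset.univ : Finset (Fin 3)))
    (fun q j => if β.1 q ≠ 0 → j.succ = β.1 q then (1 : ℝ) else 0)
  rw [Fintype.piFinset_univ] at h
  simp only [Finset.prod_ite_zero, Finset.prod_const_one, Finset.mem_univ, true_imp_iff] at h
  have h3 := prod_label_ite β 3 1
  rw [one_pow, mul_one] at h3
  rw [← h, ← h3]
  refine Finset.prod_congr rfl fun q _ => ?_
  generalize β.1 q = b
  by_cases hb : b = 0
  · simp [hb]
  · obtain ⟨j₀, rfl⟩ := Fin.exists_succ_eq.2 hb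
    simp

/-- Each of the `3^l` compatible settings has range `2 K (v m₀)^l`; on any other setting the row
vanishes. -/
lemma settingConst_siteProd {L : Matrix (Label k) (Setting k × Outcome k) ℝ} {β : Label k}
    {v : SignType → ℝ} {K r : ℝ} {m₀ : SignType} (hK : 0 ≤ K) (hv : ∀ m, |v m| ≤ v m₀)
    (hL : ∀ im, L β im = K * siteProd v β.1 im.1 im.2) :
    settingConst (fun _ => r) L β = r * 3 ^ numId β * (2 * K * v m₀ ^ numId β) ^ 2 := by
  have key (i : Setting k) : ((⨆ m, L β (i, m)) - ⨅ m, L β (i, m)) ^ 2 =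
      (2 * K * v m₀ ^ numId β) ^ 2 *
        if ∀ q, β.1 q ≠ 0 → (i q).succ = β.1 q then 1 else 0 := by
    simp only [hL]
    split_ifs with h
    · obtain ⟨⟨m₁, h₁⟩, ⟨m₂, h₂⟩⟩ := exists_siteProd_eq (v := v) m₀ β h
      have hb m := abs_le.1 (abs_siteProd_le hv β i m)
      have hsup : ⨆ m, K * siteProd v β.1 i m = K * v m₀ ^ numId β :=
        le_antisymm (ciSup_le fun m => mul_le_mul_of_nonneg_left (hb m).2 hK)
          (le_ciSup_of_le (Set.finite_range _).bddAbove m₁ (by rw [h₁]))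
      have hinf : ⨅ m, K * siteProd v β.1 i m = K * -v m₀ ^ numId β :=
        le_antisymm (ciInf_le_of_le (Set.finite_range _).bddBelow m₂ (by rw [h₂]))
          (le_ciInf fun m => mul_le_mul_of_nonneg_left (hb m).1 hK)
      rw [hsup, hinf]
      ring
    · have hz m : siteProd v β.1 i m = 0 := by
        push Not at h
        obtain ⟨q, h1, h2⟩ := h
        exact Finset.prod_eq_zero (Finset.mem_univ q) (by simp [siteFactor, h1, h2])
      simp [hz]
  simp only [settingConst, key, ← Finset.mul_sum, sum_agree]
  ring

lemma pauliConst_eq (η : ℝ) (l : ℕ) :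
    pauliConst k η l = 8 / 2 ^ k * 3 ^ (k - l) / η ^ (2 * (k - l)) := by
  rw [pauliConst, zpow_sub₀ (by norm_num), zpow_natCast]
  norm_num

lemma settingConst_pauliInverse (hk : 1 ≤ k) {η : ℝ} (hη : 0 < η) (β : Label k) :
    settingConst (fun _ => (3 : ℝ) ^ k) (pauliInverse k η) β = pauliConst k η (numId β) := by
  have hn0 := normCoeff_pos k
  rw [settingConst_siteProd (v := fun _ => 1) (m₀ := 0) (by positivity) (by simp)
    (pauliInverse_apply η β), pauliConst_eq, mul_comm 2 (k - numId β), pow_mul]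
  have h3 : (3 : ℝ) ^ k = 3 ^ numId β * 3 ^ (k - numId β) := by
    rw [← pow_add, Nat.add_sub_of_le (numId_lt β).le]
  have hn := normCoeff_sq hk
  rw [h3]
  simp only [one_pow, mul_one]
  field_simp
  linear_combination 4 * hn

lemma settingConst_lsInverse (hk : 1 ≤ k) {η : ℝ} (hη : 0 < η) (hη1 : η ≤ 1) (β : Label k) :
    settingConst (fun _ => (3 : ℝ) ^ k)
      (lsInverse (designMatrix (pauliPOVM k η) (pauliBasis k))) β =
      pauliConst k η 0 * ((2 * η * max η (2 * (1 - η)) / weightSq η) ^ 2 / 3) ^ numId β := by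
  have hn0 := normCoeff_pos k
  have hS := weightSq_pos hη
  have hw : ∃ m₀, outcomeWeight η m₀ = max η (2 * (1 - η)) := by
    rcases max_choice η (2 * (1 - η)) with h | h <;> rw [h]
    · exact ⟨1, by simp [outcomeWeight]⟩
    · exact ⟨0, by simp [outcomeWeight]⟩
  obtain ⟨m₀, hm₀⟩ := hw
  have hle m : |outcomeWeight η m| ≤ outcomeWeight η m₀ := by
    rw [hm₀]
    unfold outcomeWeight
    split_ifs
    · rw [abs_of_nonneg (by linarith)]; exact le_max_right _ _
    · rw [abs_of_pos hη]; exact le_max_left _ _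
  rw [settingConst_siteProd (m₀ := m₀) (by positivity) hle (lsInverse_apply hk hη β), hm₀,
    pauliConst_eq, Nat.sub_zero, mul_comm 2 k, pow_mul η]
  have hη' : η ^ k = η ^ numId β * η ^ (k - numId β) := by
    rw [← pow_add, Nat.add_sub_of_le (numId_lt β).le]
  have hn := normCoeff_sq hk
  rw [hη']
  generalize max η (2 * (1 - η)) = V
  simp only [div_pow, mul_pow, ← pow_mul, mul_comm 2 (numId β)]
  field_simp
  rw [pow_mul (3 : ℝ)]
  linear_combination 4 * (3 ^ numId β) ^ 2 * V ^ (numId β * 2) * hn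

/-- The difference is `4(1-η)²` in one case and `2(2η-1)² + 2(1-η)²` in the other. -/
lemma two_mul_max_le_weightSq {η : ℝ} :
    2 * η * max η (2 * (1 - η)) ≤ weightSq η := by
  unfold weightSq
  rcases max_choice η (2 * (1 - η)) with h | h <;> rw [h] <;>
    nlinarith [sq_nonneg (1 - η), sq_nonneg (η - (1 - η))]

/-- Weaker than `pauliConst k η l` by `η^{-2l}`, but the factor `3^{-l}` is all that the
redistribution of thresholds needs. -/
lemma settingConst_lsInverse_le (hk : 1 ≤ k) {η : ℝ} (hη : 0 < η) (hη1 : η ≤ 1) (β : Label k) :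
    settingConst (fun _ => (3 : ℝ) ^ k)
      (lsInverse (designMatrix (pauliPOVM k η) (pauliBasis k))) β ≤
      pauliConst k η 0 / 3 ^ numId β := by
  rw [settingConst_lsInverse hk hη hη1, div_pow _ (3 : ℝ), ← mul_div_assoc]
  have hS := weightSq_pos hη
  have h0 : 0 ≤ pauliConst k η 0 := by unfold pauliConst; positivity
  have h1 : 0 ≤ 2 * η * max η (2 * (1 - η)) / weightSq η := by positivity
  have h2 : 2 * η * max η (2 * (1 - η)) / weightSq η ≤ 1 :=
    (div_le_one hS).2 two_mul_max_le_weightSq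
  gcongr
  exact mul_le_of_le_one_right h0 (pow_le_one₀ (by positivity) (pow_le_one₀ h1 h2))

lemma settingConst_lsInverse_eq (hk : 1 ≤ k) {η : ℝ} (hη : 0 < η) (hη1 : η ≤ 1) (β : Label k)
    (h : η = 1 ∨ numId β = 0) :
    settingConst (fun _ => (3 : ℝ) ^ k)
      (lsInverse (designMatrix (pauliPOVM k η) (pauliBasis k))) β =
      pauliConst k η (numId β) := by
  rw [settingConst_lsInverse hk hη hη1]
  rcases h with rfl | h
  · have h3 : (3 : ℝ) ^ k = 3 ^ numId β * 3 ^ (k - numId β) := by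
      rw [← pow_add, Nat.add_sub_of_le (numId_lt β).le]
    rw [pauliConst_eq, pauliConst_eq, Nat.sub_zero, h3]
    norm_num [weightSq]
    field_simp
    rw [← mul_pow]
    norm_num
  · simp [h]

/-! ### Linear least squares -/

section LeastSquares

variable {ι α : Type*} [Fintype ι] [Fintype α] [DecidableEq α]

/-- Pythagoras for the least squares solution. -/
lemma norm_sq_mulVec_sub (A : Matrix ι α ℝ) (hA : IsUnit (A.transpose * A).det) (g : ι → ℝ)
    (s : α → ℝ) :
    let s₀ := ((A.transpose * A)⁻¹ * A.transpose).mulVec g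
    ‖WithLp.toLp 2 (A.mulVec s - g)‖ ^ 2 =
      ‖WithLp.toLp 2 (A.mulVec s₀ - g)‖ ^ 2 + ‖WithLp.toLp 2 (A.mulVec (s - s₀))‖ ^ 2 := by
  intro s₀
  -- The normal equations: the residual is orthogonal to the range of `A`.
  have h0 : A.transpose.mulVec (A.mulVec s₀ - g) = 0 := by
    rw [Matrix.mulVec_sub, Matrix.mulVec_mulVec, Matrix.mulVec_mulVec, ← Matrix.mul_assoc,
      Matrix.mul_nonsing_inv _ hA, Matrix.one_mul, sub_self]
  have hort : inner ℝ (WithLp.toLp 2 (A.mulVec s₀ - g)) (WithLp.toLp 2 (A.mulVec (s - s₀))) = 0 := by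
    rw [EuclideanSpace.inner_toLp_toLp, star_trivial, dotProduct_comm,
      Matrix.dotProduct_mulVec, ← Matrix.mulVec_transpose, h0, zero_dotProduct]
  have hsum : WithLp.toLp 2 (A.mulVec s - g) =
      WithLp.toLp 2 (A.mulVec s₀ - g) + WithLp.toLp 2 (A.mulVec (s - s₀)) := by
    rw [← WithLp.toLp_add, Matrix.mulVec_sub]
    congr 1
    abel
  rw [hsum, sq, sq, sq, norm_add_sq_eq_norm_sq_add_norm_sq_real hort]

end LeastSquares

/-! ### Nearest states in Bloch coordinates -/

section Projection

variable {V : Type*} [NormedAddCommGroup V] [InnerProductSpace ℝ V]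

/-- Projection onto a closed convex set: existence, uniqueness, and the fact that it does not
increase the distance to the points of the set. -/
lemma exists_unique_nearest [CompleteSpace V] {C : Set V} (hne : C.Nonempty) (hcl : IsClosed C)
    (hconv : Convex ℝ C) (u : V) :
    ∃ v ∈ C, (∀ w ∈ C, ‖v - u‖ ≤ ‖w - u‖) ∧
      ∀ v' ∈ C, (∀ w ∈ C, ‖v' - u‖ ≤ ‖w - u‖) → v' = v ∧ ∀ w ∈ C, ‖v' - w‖ ≤ ‖u - w‖ := by
  obtain ⟨v, hv, hmin⟩ := exists_norm_eq_iInf_of_complete_convex hne hcl.isComplete hconv u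
  have hb : BddBelow (Set.range fun w : C => ‖u - w‖) :=
    ⟨0, Set.forall_mem_range.2 fun _ => norm_nonneg _⟩
  have : Nonempty C := hne.to_subtype
  have near {x : V} (hx : x ∈ C) (h : ∀ w ∈ C, ‖x - u‖ ≤ ‖w - u‖) :
      ∀ w ∈ C, inner ℝ (u - x) (w - x) ≤ 0 := by
    refine (norm_eq_iInf_iff_real_inner_le_zero hconv hx).1 (le_antisymm ?_ (ciInf_le hb ⟨x, hx⟩))
    refine le_ciInf fun w => ?_
    rw [norm_sub_rev u, norm_sub_rev u]
    exact h w w.2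
  have hvmin : ∀ w ∈ C, ‖v - u‖ ≤ ‖w - u‖ := by
    intro w hw
    rw [norm_sub_rev v, norm_sub_rev w, hmin]
    exact ciInf_le hb ⟨w, hw⟩
  refine ⟨v, hv, hvmin, fun v' hv' h => ⟨?_, fun w hw => ?_⟩⟩
  · have h1 := near hv' h v hv
    have h2 := near hv hvmin v' hv'
    rw [← sub_eq_zero, ← norm_eq_zero, ← sq_eq_zero_iff]
    refine le_antisymm ?_ (sq_nonneg _)
    rw [← real_inner_self_eq_norm_sq]
    -- Adding the variational inequalities of the two minimisers gives `‖v' - v‖² ≤ 0`.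
    have e : inner ℝ (v' - v) (v' - v) =
        inner ℝ (u - v') (v - v') + inner ℝ (u - v) (v' - v) := by
      rw [← neg_sub v' v, inner_neg_right, ← sub_eq_neg_add, ← inner_sub_left]
      congr 1
      abel
    linarith
  · have h1 := near hv' h w hw
    refine le_of_sq_le_sq ?_ (norm_nonneg _)
    have e : u - w = (u - v') - (w - v') := by abel
    rw [e, norm_sub_sq_real (u - v'), norm_sub_rev v' w]
    nlinarith [sq_nonneg ‖u - v'‖]

end Projection

/-- Bloch vectors of states. -/
def stateSet (k : ℕ) : Set (EuclideanSpace ℝ (Label k)) :=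
  {s | (ofBloch (pauliBasis k) s.ofLp).PosSemidef}

lemma mem_stateSet (s : EuclideanSpace ℝ (Label k)) :
    s ∈ stateSet k ↔ IsState (ofBloch (pauliBasis k) s.ofLp) :=
  ⟨fun h => ⟨h, trace_ofBloch _⟩, fun h => h.1⟩

lemma stateSet_nonempty : (stateSet k).Nonempty := by
  refine ⟨0, ?_⟩
  have : ofBloch (pauliBasis k) (0 : EuclideanSpace ℝ (Label k)).ofLp =
      (1 / (Fintype.card (Fin k → Fin 2) : ℂ)) • 1 := by simp [ofBloch]
  rw [stateSet, Set.mem_ofPred_eq, this]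
  refine Matrix.PosSemidef.one.smul ?_
  rw [one_div, inv_nonneg]
  exact Nat.cast_nonneg _

lemma stateSet_closed : IsClosed (stateSet k) := by
  have : stateSet k = ⋂ x : (Fin k → Fin 2) → ℂ, {s | 0 ≤
      star x ⬝ᵥ (Matrix.mulVec (ofBloch (pauliBasis k) s.ofLp) x)} := by
    ext s
    simp [stateSet, Matrix.posSemidef_iff_dotProduct_mulVec, isHermitian_ofBloch]
  rw [this]
  refine isClosed_iInter fun x => isClosed_le continuous_const ?_
  unfold ofBloch
  fun_prop

lemma ofBloch_convex_comb (s t : Label k → ℝ) {a b : ℝ} (hab : a + b = 1) :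
    ofBloch (pauliBasis k) (a • s + b • t) =
      (a : ℂ) • ofBloch (pauliBasis k) s + (b : ℂ) • ofBloch (pauliBasis k) t := by
  have h : (a : ℂ) + b = 1 := by exact_mod_cast hab
  simp only [ofBloch, smul_add, Pi.add_apply, Pi.smul_apply, smul_eq_mul, Complex.ofReal_add,
    Complex.ofReal_mul, add_smul, Finset.sum_add_distrib, mul_smul, ← Finset.smul_sum]
  rw [smul_comm (a : ℂ) (1 / 2 : ℂ), smul_comm (b : ℂ) (1 / 2 : ℂ), add_add_add_comm,
    ← add_smul, h, one_smul]

lemma stateSet_convex : Convex ℝ (stateSet k) := by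
  intro s hs t ht a b ha hb hab
  rw [stateSet, Set.mem_ofPred_eq, WithLp.ofLp_add, WithLp.ofLp_smul, WithLp.ofLp_smul,
    ofBloch_convex_comb _ _ hab]
  exact (Matrix.PosSemidef.smul hs (by exact_mod_cast ha)).add
    (Matrix.PosSemidef.smul ht (by exact_mod_cast hb))

lemma IsState.ofBloch_eq (hk : 1 ≤ k) {ρ : Matrix (Fin k → Fin 2) (Fin k → Fin 2) ℂ}
    (h : IsState ρ) : ofBloch (pauliBasis k) (blochVector (pauliBasis k) ρ) = ρ :=
  ofBloch_blochVector hk h.1.1 h.2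

/-- Bloch coordinates scale all distances by one constant, so nearest states become Euclidean
projections. -/
lemma isNearestState_ofBloch_iff (hk : 1 ≤ k) (u v : EuclideanSpace ℝ (Label k)) :
    IsNearestState (ofBloch (pauliBasis k) u.ofLp) (ofBloch (pauliBasis k) v.ofLp) ↔
      v ∈ stateSet k ∧ ∀ w ∈ stateSet k, ‖v - u‖ ≤ ‖w - u‖ := by
  have hle (v w : EuclideanSpace ℝ (Label k)) :
      hsNorm (ofBloch (pauliBasis k) v.ofLp - ofBloch (pauliBasis k) u.ofLp) ≤
        hsNorm (ofBloch (pauliBasis k) w.ofLp - ofBloch (pauliBasis k) u.ofLp) ↔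
      ‖v - u‖ ≤ ‖w - u‖ := by
    rw [hsNorm_ofBloch_sub hk, hsNorm_ofBloch_sub hk, mul_le_mul_iff_right₀ (by positivity),
      WithLp.toLp_sub, WithLp.toLp_sub, WithLp.toLp_ofLp, WithLp.toLp_ofLp, WithLp.toLp_ofLp]
  rw [IsNearestState, ← mem_stateSet]
  refine and_congr_right fun _ => ⟨fun h w hw => (hle v w).1 (h _ ((mem_stateSet w).1 hw)),
    fun h τ hτ => ?_⟩
  obtain ⟨w, rfl⟩ : ∃ w : EuclideanSpace ℝ (Label k), ofBloch (pauliBasis k) w.ofLp = τ :=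
    ⟨WithLp.toLp 2 (blochVector (pauliBasis k) τ), hτ.ofBloch_eq hk⟩
  exact (hle v w).2 (h w ((mem_stateSet w).2 hτ))

lemma existsUnique_isNearestState (hk : 1 ≤ k) (s : Label k → ℝ) :
    ∃! ρ, IsNearestState (ofBloch (pauliBasis k) s) ρ := by
  obtain ⟨v, hv, hmin, huniq⟩ := exists_unique_nearest stateSet_nonempty stateSet_closed
    (stateSet_convex (k := k)) (WithLp.toLp 2 s)
  refine ⟨ofBloch (pauliBasis k) v.ofLp,
    (isNearestState_ofBloch_iff hk (WithLp.toLp 2 s) v).2 ⟨hv, hmin⟩, fun ρ hρ => ?_⟩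
  obtain ⟨w, rfl⟩ : ∃ w : EuclideanSpace ℝ (Label k), ofBloch (pauliBasis k) w.ofLp = ρ :=
    ⟨WithLp.toLp 2 (blochVector (pauliBasis k) ρ), hρ.1.ofBloch_eq hk⟩
  obtain ⟨h1, h2⟩ := (isNearestState_ofBloch_iff hk (WithLp.toLp 2 s) w).1 hρ
  rw [(huniq w h1 h2).1]

/-- The nearest state is at least as close to any state as the original matrix. -/
lemma IsNearestState.norm_blochVector_sub_le (hk : 1 ≤ k) {s : Label k → ℝ}
    {ρ' ρ : Matrix (Fin k → Fin 2) (Fin k → Fin 2) ℂ}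
    (h : IsNearestState (ofBloch (pauliBasis k) s) ρ') (hρ : IsState ρ) :
    ‖WithLp.toLp 2 (blochVector (pauliBasis k) ρ' - blochVector (pauliBasis k) ρ)‖ ≤
      ‖WithLp.toLp 2 (s - blochVector (pauliBasis k) ρ)‖ := by
  obtain ⟨v, hv, hmin, huniq⟩ := exists_unique_nearest stateSet_nonempty stateSet_closed
    (stateSet_convex (k := k)) (WithLp.toLp 2 s)
  rw [← h.1.ofBloch_eq hk] at h
  obtain ⟨h1, h2⟩ := (isNearestState_ofBloch_iff hk (WithLp.toLp 2 s) (WithLp.toLp 2 _)).1 h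
  refine (huniq _ h1 h2).2 (WithLp.toLp 2 (blochVector (pauliBasis k) ρ)) ?_
  rw [mem_stateSet]
  simpa only [hρ.ofBloch_eq hk] using hρ

/-! ### The linear estimates -/

lemma bornProb_ofBloch {J M : Type*} (P : J → M → Matrix (Fin k → Fin 2) (Fin k → Fin 2) ℂ)
    (s : Label k → ℝ) :
    bornProb P (ofBloch (pauliBasis k) s) =
      (designMatrix P (pauliBasis k)).mulVec s + povmOffset P := by
  ext jm
  simp only [bornProb, ofBloch, mul_add, Matrix.mul_smul, mul_one, Matrix.mul_sum,
    Matrix.trace_add, Matrix.trace_smul, Matrix.trace_sum, Complex.add_re, smul_eq_mul,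
    Pi.add_apply, Matrix.mulVec, dotProduct, designMatrix, povmOffset, Matrix.of_apply]
  rw [add_comm]
  congr 1
  · rw [show (1 / 2 : ℂ) = ((1 / 2 : ℝ) : ℂ) by norm_num, Complex.re_ofReal_mul, Complex.re_sum,
      Finset.mul_sum]
    refine Finset.sum_congr rfl fun β _ => ?_
    rw [Complex.re_ofReal_mul]
    ring
  · rw [one_div, ← Complex.ofReal_natCast, ← Complex.ofReal_inv, Complex.re_ofReal_mul, div_eq_inv_mul]

lemma bornProb_eq (hk : 1 ≤ k) {J M : Type*}
    (P : J → M → Matrix (Fin k → Fin 2) (Fin k → Fin 2) ℂ)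
    {σ : Matrix (Fin k → Fin 2) (Fin k → Fin 2) ℂ} (hσ : σ.IsHermitian) (htr : σ.trace = 1) :
    bornProb P σ - povmOffset P =
      (designMatrix P (pauliBasis k)).mulVec (blochVector (pauliBasis k) σ) := by
  conv_lhs => rw [← ofBloch_blochVector hk hσ htr, bornProb_ofBloch]
  rw [add_sub_cancel_right]

/-- A left inverse of the design matrix recovers the Bloch vector from the probabilities. -/
lemma blochVector_eq_mulVec (hk : 1 ≤ k) {J M : Type*} [Fintype J] [Fintype M]
    {P : J → M → Matrix (Fin k → Fin 2) (Fin k → Fin 2) ℂ} {L : Matrix (Label k) (J × M) ℝ}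
    (hL : L * designMatrix P (pauliBasis k) = 1)
    {σ : Matrix (Fin k → Fin 2) (Fin k → Fin 2) ℂ} (hσ : σ.IsHermitian) (htr : σ.trace = 1) :
    blochVector (pauliBasis k) σ = L.mulVec (bornProb P σ - povmOffset P) := by
  rw [bornProb_eq hk P hσ htr, Matrix.mulVec_mulVec, hL, Matrix.one_mulVec]

section

variable {J M : Type*} [Fintype J] [Fintype M]
  {P : J → M → Matrix (Fin k → Fin 2) (Fin k → Fin 2) ℂ} {L : Matrix (Label k) (J × M) ℝ}

lemma mulVec_injective_of_left_inverse {A : Matrix (J × M) (Label k) ℝ} (hL : L * A = 1) :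
    Function.Injective A.mulVec := by
  intro s t h
  have := congrArg L.mulVec h
  simpa [Matrix.mulVec_mulVec, hL] using this

lemma isUnit_det_gram {A : Matrix (J × M) (Label k) ℝ} (hL : L * A = 1) :
    IsUnit (A.transpose * A).det := by
  have h := Matrix.PosDef.conjTranspose_mul_self A (mulVec_injective_of_left_inverse hL)
  rw [Matrix.conjTranspose_eq_transpose_of_trivial] at h
  exact h.det_pos.ne'.isUnit

lemma lsInverse_mul {A : Matrix (J × M) (Label k) ℝ} (hL : L * A = 1) : lsInverse A * A = 1 := by
  rw [lsInverse, Matrix.mul_assoc, Matrix.nonsing_inv_mul _ (isUnit_det_gram hL)]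

/-- The linear least squares estimate is given by `(AᵀA)⁻¹Aᵀ`. -/
lemma isLLS_iff (hk : 1 ≤ k) (hL : L * designMatrix P (pauliBasis k) = 1) (f : J × M → ℝ)
    (σ : Matrix (Fin k → Fin 2) (Fin k → Fin 2) ℂ) :
    IsLLS P f σ ↔ σ = ofBloch (pauliBasis k)
      ((lsInverse (designMatrix P (pauliBasis k))).mulVec (f - povmOffset P)) := by
  set A := designMatrix P (pauliBasis k) with hA
  set s₀ := (lsInverse A).mulVec (f - povmOffset P) with hs₀
  have hpyth (s : Label k → ℝ) :
      ‖WithLp.toLp 2 (bornProb P (ofBloch (pauliBasis k) s) - f)‖ ^ 2 =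
        ‖WithLp.toLp 2 (bornProb P (ofBloch (pauliBasis k) s₀) - f)‖ ^ 2 +
          ‖WithLp.toLp 2 (A.mulVec (s - s₀))‖ ^ 2 := by
    have h := norm_sq_mulVec_sub A (isUnit_det_gram hL) (f - povmOffset P) s
    have e (t : Label k → ℝ) : A.mulVec t - (f - povmOffset P) =
        bornProb P (ofBloch (pauliBasis k) t) - f := by
      rw [bornProb_ofBloch, ← hA]; abel
    rw [← e, ← e]
    exact h
  constructor
  · rintro ⟨⟨hσ, htr⟩, hmin⟩
    have h1 := hmin _ (isHermitian_ofBloch s₀) (trace_ofBloch s₀)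
    rw [← ofBloch_blochVector hk hσ htr] at h1 ⊢
    have h2 := hpyth (blochVector (pauliBasis k) σ)
    have h3 := pow_le_pow_left₀ (norm_nonneg _) h1 2
    -- Minimality kills the excess in Pythagoras; injectivity of `A` then identifies the minimiser.
    have h4 : ‖WithLp.toLp 2 (A.mulVec (blochVector (pauliBasis k) σ - s₀))‖ = 0 := by
      rw [← sq_eq_zero_iff]
      exact le_antisymm (by linarith) (sq_nonneg _)
    rw [norm_eq_zero, WithLp.toLp_eq_zero, ← Matrix.mulVec_zero A] at h4
    rw [sub_eq_zero.1 (mulVec_injective_of_left_inverse hL h4)]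
  · rintro rfl
    refine ⟨⟨isHermitian_ofBloch _, trace_ofBloch _⟩, fun τ hτ htr => ?_⟩
    refine le_of_sq_le_sq ?_ (norm_nonneg _)
    rw [← ofBloch_blochVector hk hτ htr, hpyth (blochVector (pauliBasis k) τ)]
    exact le_add_of_nonneg_right (sq_nonneg _)

lemma isENM_iff (hk : 1 ≤ k) (hL : L * designMatrix P (pauliBasis k) = 1)
    (f : J × M → ℝ) (ρ : Matrix (Fin k → Fin 2) (Fin k → Fin 2) ℂ) :
    IsENM P f ρ ↔
      IsENMWith P (pauliBasis k) (lsInverse (designMatrix P (pauliBasis k))) f ρ := by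
  simp only [IsENM, isLLS_iff hk hL, exists_eq_left, IsENMWith]

end

/-! ### Trace distance -/

lemma hsNorm_sq {D : Type*} [Fintype D] (X : Matrix D D ℂ) :
    hsNorm X ^ 2 = ∑ i, ∑ j, ‖X j i‖ ^ 2 := by
  have h : (X.conjTranspose * X).trace.re = ∑ i, ∑ j, ‖X j i‖ ^ 2 := by
    simp only [Matrix.trace, Matrix.diag_apply, Matrix.mul_apply, Matrix.conjTranspose_apply,
      Complex.re_sum]
    refine Finset.sum_congr rfl fun i _ => Finset.sum_congr rfl fun j _ => ?_
    rw [Complex.star_def, ← Complex.normSq_eq_conj_mul_self, Complex.ofReal_re,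
      Complex.normSq_eq_norm_sq]
  rw [hsNorm, Real.sq_sqrt (by rw [h]; positivity), h]

/-- Cauchy–Schwarz on the diagonal; the off-diagonal entries only enlarge the right-hand side. -/
lemma trace_re_sq_le {D : Type*} [Fintype D] (X : Matrix D D ℂ) :
    X.trace.re ^ 2 ≤ Fintype.card D * hsNorm X ^ 2 := by
  rw [hsNorm_sq, Matrix.trace, Complex.re_sum]
  refine sq_sum_le_card_mul_sum_sq.trans ?_
  rw [Finset.card_univ]
  gcongr with i
  refine le_trans ?_ (Finset.single_le_sum (f := fun j => ‖X j i‖ ^ 2)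
    (fun _ _ => sq_nonneg _) (Finset.mem_univ i))
  rw [← sq_abs]
  exact pow_le_pow_left₀ (abs_nonneg _) (Complex.abs_re_le_norm _) 2

lemma traceDist_sq_le {D : Type*} [Fintype D] [DecidableEq D] (ρ' ρ : Matrix D D ℂ) :
    traceDist ρ' ρ ^ 2 ≤ Fintype.card D / 4 * hsNorm (ρ' - ρ) ^ 2 := by
  have h1 : hsNorm (CFC.abs (ρ' - ρ)) = hsNorm (ρ' - ρ) := by
    have h2 : (CFC.abs (ρ' - ρ)).conjTranspose = CFC.abs (ρ' - ρ) :=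
      (CFC.abs_nonneg (ρ' - ρ)).isSelfAdjoint
    rw [hsNorm, hsNorm, h2, CFC.abs_mul_abs, Matrix.star_eq_conjTranspose]
  have := trace_re_sq_le (CFC.abs (ρ' - ρ))
  rw [h1] at this
  rw [traceDist, mul_pow]
  linarith

/-- Deviations of the linear estimate bound the trace distance of the nearest state. -/
lemma traceDist_le_of_isNearestState (hk : 1 ≤ k) {s : Label k → ℝ}
    {ρ' ρ : Matrix (Fin k → Fin 2) (Fin k → Fin 2) ℂ}
    (h : IsNearestState (ofBloch (pauliBasis k) s) ρ') (hρ : IsState ρ) {δ : ℝ} (hδ : 0 ≤ δ)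
    {ε : Label k → ℝ} (hε : ∑ β, ε β ^ 2 ≤ 8 * δ ^ 2 / 2 ^ k)
    (hs : ∀ β, |s β - blochVector (pauliBasis k) ρ β| ≤ ε β) : traceDist ρ' ρ ≤ δ := by
  refine le_of_sq_le_sq ?_ hδ
  have h1 := h.norm_blochVector_sub_le hk hρ
  have h2 : ‖WithLp.toLp 2 (s - blochVector (pauliBasis k) ρ)‖ ^ 2 ≤ 8 * δ ^ 2 / 2 ^ k := by
    rw [EuclideanSpace.norm_sq_eq]
    refine (Finset.sum_le_sum fun β _ => ?_).trans hε
    exact pow_le_pow_left₀ (norm_nonneg _) (hs β) 2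
  have h3 := traceDist_sq_le ρ' ρ
  rw [← h.1.ofBloch_eq hk, ← hρ.ofBloch_eq hk, hsNorm_ofBloch_sub hk, mul_pow,
    Real.sq_sqrt (by norm_num), h.1.ofBloch_eq hk, hρ.ofBloch_eq hk] at h3
  have h4 := (pow_le_pow_left₀ (norm_nonneg _) h1 2).trans h2
  simp only [Fintype.card_fun, Fintype.card_fin, Nat.cast_pow, Nat.cast_ofNat] at h3
  -- The budget `8δ²/2^k` for the squared thresholds is chosen so that this product is exactly `δ²`.
  calc _ ≤ _ := h3
    _ ≤ (2 : ℝ) ^ k / 4 * (1 / 2 * (8 * δ ^ 2 / 2 ^ k)) := by gcongr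
    _ = δ ^ 2 := by field_simp; norm_num

/-! ### Concentration of the linear estimates -/

lemma sum_mul_relFreq {J M : Type*} [Fintype J] [Fintype M] [DecidableEq M] {n : ℕ} (hn : 1 ≤ n)
    (x : J → Fin n → M) (g : J × M → ℝ) :
    n * ∑ jm, g jm * relFreq x jm = ∑ jq : J × Fin n, g (jq.1, x jq.1 jq.2) := by
  have hn0 : (n : ℝ) ≠ 0 := by positivity
  rw [Fintype.sum_prod_type, Fintype.sum_prod_type, Finset.mul_sum]
  refine Finset.sum_congr rfl fun j _ => ?_
  simp only [relFreq, Finset.card_filter, Nat.cast_sum, Finset.mul_sum]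
  have (m : M) : (n : ℝ) * (g (j, m) * ((∑ q, ((if x j q = m then 1 else 0 : ℕ) : ℝ)) / n)) =
      ∑ q, if x j q = m then g (j, m) else 0 := by
    rw [mul_left_comm, mul_div_cancel₀ _ hn0, Finset.mul_sum]
    refine Finset.sum_congr rfl fun q _ => ?_
    split_ifs <;> simp
  simp only [this]
  rw [Finset.sum_comm]
  simp

section Concentration

open MeasureTheory ProbabilityTheory

variable {Ω J M : Type*} [MeasurableSpace Ω] {μ : Measure Ω} [IsProbabilityMeasure μ]
  [Fintype J] [Fintype M] [MeasurableSpace M] [MeasurableSingletonClass M] {n : ℕ}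

lemma integral_comp_eq_sum {X : Ω → M} (hX : Measurable X) (g : M → ℝ) :
    ∫ ω, g (X ω) ∂μ = ∑ m, μ.real {ω | X ω = m} * g m := by
  have hg : Measurable g := measurable_of_finite g
  rw [← integral_map hX.aemeasurable hg.aestronglyMeasurable,
    integral_fintype (by
      have := Measure.isProbabilityMeasure_map (μ := μ) hX.aemeasurable
      exact Integrable.of_finite)]
  refine Finset.sum_congr rfl fun m _ => ?_
  rw [map_measureReal_apply hX (measurableSet_singleton m), smul_eq_mul]
  rfl

/-- Hoeffding's inequality for a linear function of the relative frequencies. -/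
lemma measure_le_sum_relFreq_sub [DecidableEq M] (hn : 1 ≤ n) {X : J → Fin n → Ω → M}
    (hX : ∀ j q, Measurable (X j q))
    (hind : iIndepFun (fun jq : J × Fin n => X jq.1 jq.2) μ) {p : J × M → ℝ}
    (hp : ∀ j q m, μ.real {ω | X j q ω = m} = p (j, m)) {g : J × M → ℝ} {a b : J → ℝ}
    (ha : ∀ j m, a j ≤ g (j, m)) (hb : ∀ j m, g (j, m) ≤ b j) {ε : ℝ} (hε : 0 ≤ ε) :
    μ.real {ω | ε ≤ ∑ jm, g jm * (relFreq (fun j q => X j q ω) jm - p jm)} ≤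
      Real.exp (-(2 * ε ^ 2 * n / ∑ j, (b j - a j) ^ 2)) := by
  have hn0 : (0 : ℝ) < n := by positivity
  have hg j : Measurable fun m => g (j, m) := measurable_of_finite _
  -- Hoeffding's lemma for a single trial, whose value lies in an interval of length `b j - a j`.
  have hsub (jq : J × Fin n) : HasSubgaussianMGF
      (fun ω => g (jq.1, X jq.1 jq.2 ω) - ∑ m, p (jq.1, m) * g (jq.1, m))
      ((‖b jq.1 - a jq.1‖₊ / 2) ^ 2) μ := by
    have h := hasSubgaussianMGF_of_mem_Icc (μ := μ) (X := fun ω => g (jq.1, X jq.1 jq.2 ω))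
      (a := a jq.1) (b := b jq.1) ((hg jq.1).comp (hX jq.1 jq.2)).aemeasurable
      (Filter.Eventually.of_forall fun ω => ⟨ha _ _, hb _ _⟩)
    rw [integral_comp_eq_sum (hX jq.1 jq.2) (fun m => g (jq.1, m))] at h
    simpa only [hp] using h
  have hind' := hind.comp (fun jq m => g (jq.1, m) - ∑ m, p (jq.1, m) * g (jq.1, m))
    (fun jq => (hg jq.1).sub_const _)
  have h := HasSubgaussianMGF.measure_sum_ge_le_of_iIndepFun hind' (s := Finset.univ)
    (fun jq _ => hsub jq) (ε := n * ε) (by positivity)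
  refine (measureReal_mono fun ω hω => ?_).trans (h.trans_eq ?_)
  · simp only [Set.mem_ofPred_eq, Function.comp_apply] at hω ⊢
    have h1 := sum_mul_relFreq hn (fun j q => X j q ω) g
    rw [Finset.sum_sub_distrib, ← h1]
    have h2 : ∑ jq : J × Fin n, ∑ m, p (jq.1, m) * g (jq.1, m) = n * ∑ jm, g jm * p jm := by
      simp [Fintype.sum_prod_type, ← Finset.mul_sum, mul_comm (g _)]
    rw [h2, ← mul_sub, ← Finset.sum_sub_distrib]
    simp only [← mul_sub]
    gcongr
  · congr 1
    have : ((∑ jq : J × Fin n, (‖b jq.1 - a jq.1‖₊ / 2) ^ 2 : NNReal) : ℝ) =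
        n * ((∑ j, (b j - a j) ^ 2) / 4) := by
      push_cast
      simp only [Fintype.sum_prod_type, Finset.sum_const, Finset.card_univ, Fintype.card_fin,
        nsmul_eq_mul, ← Finset.mul_sum, div_pow, Real.norm_eq_abs, sq_abs,
        ← Finset.sum_div]
      norm_num
      ring
    rw [this]
    generalize ∑ j, (b j - a j) ^ 2 = S
    -- For `S = 0`, division by zero makes both exponents `0`, and the bound is the trivial `1`.
    rcases eq_or_ne S 0 with rfl | hS
    · simp
    · field_simp
      norm_num

/-- Two-sided bound in terms of the ranges of the coefficients. -/
lemma measure_not_abs_sum_relFreq_sub_le [DecidableEq M] (hn : 1 ≤ n) {X : J → Fin n → Ω → M}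
    (hX : ∀ j q, Measurable (X j q))
    (hind : iIndepFun (fun jq : J × Fin n => X jq.1 jq.2) μ) {p : J × M → ℝ}
    (hp : ∀ j q m, μ.real {ω | X j q ω = m} = p (j, m)) (g : J × M → ℝ) {ε : ℝ} (hε : 0 ≤ ε) :
    μ.real {ω | ¬ |∑ jm, g jm * (relFreq (fun j q => X j q ω) jm - p jm)| ≤ ε} ≤
      2 * Real.exp (-(2 * ε ^ 2 * n / ∑ j, ((⨆ m, g (j, m)) - ⨅ m, g (j, m)) ^ 2)) := by
  have hle j m : g (j, m) ≤ ⨆ m, g (j, m) :=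
    le_ciSup (f := fun m => g (j, m)) (Set.finite_range _).bddAbove m
  have hge j m : ⨅ m, g (j, m) ≤ g (j, m) :=
    ciInf_le (f := fun m => g (j, m)) (Set.finite_range _).bddBelow m
  have h1 := measure_le_sum_relFreq_sub hn hX hind hp hge hle hε
  have h2 := measure_le_sum_relFreq_sub hn hX hind hp (g := fun jm => -g jm)
    (a := fun j => -⨆ m, g (j, m)) (b := fun j => -⨅ m, g (j, m))
    (fun j m => neg_le_neg (hle j m)) (fun j m => neg_le_neg (hge j m)) hε
  simp only [neg_sub_neg, neg_mul, Finset.sum_neg_distrib] at h2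
  rw [two_mul]
  refine (measureReal_mono fun ω hω => ?_).trans ((measureReal_union_le _ _).trans (add_le_add h1 h2))
  simp only [Set.mem_ofPred_eq, not_le, lt_abs, Set.mem_union] at hω ⊢
  exact hω.imp le_of_lt le_of_lt

end Concentration

open MeasureTheory in
/-- Confidence level of the state nearest to a linear estimate, for any admissible thresholds of
the Bloch coordinates. -/
lemma confidence_of_thresholds (hk : 1 ≤ k) {n : ℕ} (hn : 1 ≤ n) {η δ : ℝ} (hδ : 0 ≤ δ)
    {L : Matrix (Label k) (Setting k × Outcome k) ℝ}
    (hL : L * designMatrix (pauliPOVM k η) (pauliBasis k) = 1)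
    {Ω : Type*} [MeasurableSpace Ω] (μ : Measure Ω) [IsProbabilityMeasure μ]
    {ρ : Matrix (Fin k → Fin 2) (Fin k → Fin 2) ℂ} {X : Setting k → Fin n → Ω → Outcome k}
    (hρ : IsState ρ) (hX : IsExperiment μ k n η ρ X)
    {est : Ω → Matrix (Fin k → Fin 2) (Fin k → Fin 2) ℂ}
    (hest : ∀ ω, IsENMWith (pauliPOVM k η) (pauliBasis k) L (relFreq fun i q => X i q ω) (est ω))
    {ε : Label k → ℝ} (hε0 : ∀ β, 0 ≤ ε β) (hε : ∑ β, ε β ^ 2 ≤ 8 * δ ^ 2 / 2 ^ k) :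
    1 - 2 * ∑ β, Real.exp (-(2 * ε β ^ 2 * (3 ^ k * n) / settingConst (fun _ => 3 ^ k) L β)) ≤
      μ.real {ω | traceDist (est ω) ρ ≤ δ} := by
  let mO : MeasurableSpace (Outcome k) := ⊤
  have hb β := measure_not_abs_sum_relFreq_sub_le hn hX.measurable hX.indep hX.law
    (fun im => L β im) (hε0 β)
  have hsub : {ω | traceDist (est ω) ρ ≤ δ}ᶜ ⊆ ⋃ β, {ω | ¬ |∑ im, L β im *
      (relFreq (fun i q => X i q ω) im - bornProb (pauliPOVM k η) ρ im)| ≤ ε β} := by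
    intro ω hω
    by_contra h
    refine hω (traceDist_le_of_isNearestState hk (hest ω) hρ hδ hε fun β => ?_)
    simp only [Set.mem_iUnion, Set.mem_ofPred_eq, not_exists, not_not] at h
    have e : L.mulVec (relFreq (fun i q => X i q ω) - povmOffset (pauliPOVM k η)) β -
        blochVector (pauliBasis k) ρ β =
        ∑ im, L β im * (relFreq (fun i q => X i q ω) im - bornProb (pauliPOVM k η) ρ im) := by
      rw [blochVector_eq_mulVec hk hL hρ.1.1 hρ.2, ← Pi.sub_apply, ← Matrix.mulVec_sub,
        sub_sub_sub_cancel_right]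
      rfl
    rw [e]
    exact h β
  have h1 : μ.real {ω | traceDist (est ω) ρ ≤ δ}ᶜ ≤ ∑ β, 2 * Real.exp
      (-(2 * ε β ^ 2 * (3 ^ k * n) / settingConst (fun _ => 3 ^ k) L β)) := by
    refine (measureReal_mono hsub).trans ((measureReal_iUnion_fintype_le _).trans
      (Finset.sum_le_sum fun β _ => (hb β).trans_eq ?_))
    -- The factor `3^k` inside `c_β` turns the `n` of Hoeffding's bound into `N = 3^k n`.
    rw [settingConst, ← Finset.mul_sum, mul_left_comm, mul_div_mul_left _ _ (by positivity)]
  -- Subadditivity suffices here, so `est` need not be measurable.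
  have h2 : 1 ≤ μ.real {ω | traceDist (est ω) ρ ≤ δ} + μ.real {ω | traceDist (est ω) ρ ≤ δ}ᶜ := by
    have := measureReal_union_le (μ := μ) {ω | traceDist (est ω) ρ ≤ δ}
      {ω | traceDist (est ω) ρ ≤ δ}ᶜ
    rwa [Set.union_compl_self, probReal_univ] at this
  rw [← Finset.mul_sum] at h1
  linarith

/-! ### Summation over the Pauli labels -/

/-- Strings are grouped by their set `S` of identity positions, with `3^(k-|S|)` strings for each
`S`. The term `l = k` is the excluded all-identity string. -/
lemma sum_label (g : ℕ → ℝ) :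
    ∑ β : Label k, g (numId β) =
      ∑ l ∈ Finset.range k, 3 ^ (k - l) * (k.choose l : ℝ) * g l := by
  let zeros : (Fin k → Fin 4) → Finset (Fin k) := fun β => Finset.univ.filter fun q => β q = 0
  have hcard (S : Finset (Fin k)) :
      (Finset.univ.filter fun β : Fin k → Fin 4 => zeros β = S).card = 3 ^ (k - S.card) := by
    have : (Finset.univ.filter fun β : Fin k → Fin 4 => zeros β = S) =
        Fintype.piFinset fun q => if q ∈ S then {0} else {0}ᶜ := by
      ext β
      simp only [zeros, Finset.mem_filter, Finset.mem_univ, true_and, Fintype.mem_piFinset,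
        Finset.ext_iff]
      refine forall_congr' fun q => ?_
      split_ifs with h <;> simp [h]
    rw [this, Fintype.card_piFinset]
    have (q : Fin k) : (if q ∈ S then {0} else {0}ᶜ : Finset (Fin 4)).card =
        if q ∈ S then 1 else 3 := by split_ifs <;> rfl
    simp only [this]
    rw [Finset.prod_ite, Finset.prod_const_one, one_mul, Finset.prod_const, Finset.filter_not,
      Finset.filter_mem_eq_inter, Finset.univ_inter, Finset.card_univ_sdiff, Fintype.card_fin]
  have hall : ∑ β : Fin k → Fin 4, g (zeros β).card =
      ∑ l ∈ Finset.range (k + 1), 3 ^ (k - l) * (k.choose l : ℝ) * g l := by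
    rw [← Finset.sum_fiberwise_of_maps_to (s := Finset.univ)
      (t := (Finset.univ : Finset (Fin k)).powerset) (g := zeros) (by simp)]
    have (S : Finset (Fin k)) :
        ∑ β ∈ Finset.univ.filter (fun β : Fin k → Fin 4 => zeros β = S), g (zeros β).card =
          3 ^ (k - S.card) * g S.card := by
      rw [Finset.sum_congr rfl (g := fun _ => g S.card) (by
        intro β hβ
        rw [(Finset.mem_filter.1 hβ).2]), Finset.sum_const, hcard, nsmul_eq_mul]
      push_cast
      rfl
    simp only [this]
    rw [Finset.sum_powerset_apply_card (fun l => (3 : ℝ) ^ (k - l) * g l)]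
    simp only [Finset.card_univ, Fintype.card_fin, nsmul_eq_mul]
    exact Finset.sum_congr rfl fun l _ => by ring
  rw [sum_strings, Finset.sum_range_succ] at hall
  have h0 : (zeros 0).card = k := by simp [zeros]
  simp only [h0, Nat.sub_self, pow_zero, Nat.choose_self, Nat.cast_one, one_mul] at hall
  have : ∑ β : Label k, g (zeros β.1).card = ∑ β : Label k, g (numId β) := rfl
  linarith

lemma card_label : (Fintype.card (Label k) : ℝ) = 4 ^ k - 1 := by
  have h := sum_strings (k := k) (fun _ => (1 : ℝ))
  simp only [Finset.sum_const, Finset.card_univ, Fintype.card_fun, Fintype.card_fin, nsmul_eq_mul,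
    mul_one, Nat.cast_pow, Nat.cast_ofNat] at h
  linarith

lemma sum_label_ite (hk : 1 ≤ k) (a b : ℝ) :
    ∑ β : Label k, (if numId β = 0 then a else b) = 3 ^ k * a + (4 ^ k - 1 - 3 ^ k) * b := by
  have h : ∑ β : Label k, (if numId β = 0 then (a - b) else 0) = 3 ^ k * (a - b) := by
    rw [sum_label fun l => if l = 0 then a - b else 0]
    simp only [mul_ite, mul_zero]
    rw [Finset.sum_ite_eq', if_pos (Finset.mem_range.2 hk)]
    simp
  have e (β : Label k) : (if numId β = 0 then a else b) =
      (if numId β = 0 then (a - b) else 0) + b := by split_ifs <;> ring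
  simp only [e]
  rw [Finset.sum_add_distrib, h, Finset.sum_const, Finset.card_univ, nsmul_eq_mul, card_label]
  ring

lemma three_pow_le (hk : 1 ≤ k) : (3 : ℝ) ^ k ≤ 4 ^ k - 1 := by
  obtain ⟨j, rfl⟩ := Nat.exists_eq_add_of_le' hk
  have h1 : (1 : ℝ) ≤ 3 ^ j := one_le_pow₀ (by norm_num)
  have h2 : (3 : ℝ) ^ j ≤ 4 ^ j := pow_le_pow_left₀ (by norm_num) (by norm_num) j
  rw [pow_succ, pow_succ]
  linarith

/-! ### Confidence levels -/

lemma pauliExponent_eq (hk : 1 ≤ k) {η : ℝ} (hη : 0 < η) (δ N : ℝ) (l : ℕ) :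
    16 / (2 ^ k * (4 ^ k - 1)) / pauliConst k η l * δ ^ 2 * N =
      2 / (2 ^ (2 * k) - 1) * (η ^ (2 * (k - l)) / 3 ^ (k - l)) * δ ^ 2 * N := by
  have h4 : (0 : ℝ) < 4 ^ k - 1 := (by positivity : (0 : ℝ) < 3 ^ k).trans_le (three_pow_le hk)
  rw [pauliConst_eq, pow_mul (2 : ℝ) 2 k, show (2 : ℝ) ^ 2 = 4 by norm_num]
  field_simp
  ring

lemma confidenceLevel_pauliInverse (hk : 1 ≤ k) {η : ℝ} (hη : 0 < η) (δ N : ℝ) :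
    confidenceLevel (traceDistCoeff (2 ^ k))
      (settingConst (fun _ => (3 : ℝ) ^ k) (pauliInverse k η)) δ N = pauliCL k η δ N := by
  have hb : traceDistCoeff (2 ^ k) = 16 / (2 ^ k * (4 ^ k - 1)) := by
    rw [traceDistCoeff, ← pow_mul, mul_comm k 2, pow_mul, show (2 : ℝ) ^ 2 = 4 by norm_num]
  simp only [confidenceLevel, settingConst_pauliInverse hk hη, hb, pauliExponent_eq hk hη]
  rw [sum_label fun l => Real.exp
    (-(2 / (2 ^ (2 * k) - 1) * (η ^ (2 * (k - l)) / 3 ^ (k - l)) * δ ^ 2 * N)), pauliCL]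

/-- With `y = Rτ/3` and `e^{-y} ≤ 1/(1+y)`, it suffices that `R e^{-τ} (1+y) ≤ y`. This splits into
`e^{-τ} ≤ 1/6 ≤ τ/6`, as `τ ≥ 1`, and `R e^{-τ} τ/3 ≤ τ/6`. -/
lemma exp_neg_add_mul_exp_le {R τ : ℝ} (hR : 0 ≤ R) (h6 : Real.exp (-τ) ≤ 1 / 6)
    (h2 : R * Real.exp (-τ) ≤ 1 / 2) :
    Real.exp (-(R * τ / 3)) + R * Real.exp (-τ) ≤ 1 := by
  have hτ : 1 ≤ τ := by
    by_contra h
    have h1 : Real.exp (-1) < Real.exp (-τ) := Real.exp_lt_exp.2 (by linarith)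
    rw [Real.exp_neg] at h1
    have h3 : (3 : ℝ)⁻¹ ≤ (Real.exp 1)⁻¹ :=
      inv_anti₀ (Real.exp_pos 1) (Real.exp_one_lt_three.le)
    norm_num at h3
    linarith
  set y := R * τ / 3 with hy
  have hy0 : 0 ≤ y := by positivity
  have h1 : Real.exp (-y) ≤ 1 / (1 + y) := by
    rw [Real.exp_neg, ← one_div]
    exact one_div_le_one_div_of_le (by positivity) (by linarith [Real.add_one_le_exp y])
  have h3 : R * Real.exp (-τ) * (1 + y) ≤ y := by
    have e : R * Real.exp (-τ) * (1 + y) =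
        R * (Real.exp (-τ) + R * Real.exp (-τ) * (τ / 3)) := by rw [hy]; ring
    have e' : y = R * (τ / 6 + 1 / 2 * (τ / 3)) := by rw [hy]; ring
    rw [e, e']
    gcongr
    linarith
  have h4 : R * Real.exp (-τ) ≤ y / (1 + y) := (le_div_iff₀ (by positivity)).2 h3
  calc _ ≤ 1 / (1 + y) + y / (1 + y) := add_le_add h1 h4
    _ = 1 := by field_simp

/-- Lowering the thresholds of the labels with identity factors in favour of the others only
improves the confidence level, unless that level is trivial. -/
lemma threshold_sum_le (hk : 1 ≤ k) {τ : ℝ} (hτ : 2 * 3 ^ k * Real.exp (-τ) ≤ 1) :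
    3 ^ k * Real.exp (-((1 + (4 ^ k - 1 - 3 ^ k) / 3 ^ k / 3) * τ)) +
      (4 ^ k - 1 - 3 ^ k) * Real.exp (-(2 * τ)) ≤ 3 ^ k * Real.exp (-τ) := by
  have h3 : (0 : ℝ) < 3 ^ k := by positivity
  have h33 : (3 : ℝ) ≤ 3 ^ k := le_self_pow₀ (by norm_num) (by omega)
  have hT := three_pow_le hk
  set R : ℝ := (4 ^ k - 1 - 3 ^ k) / 3 ^ k with hR
  have hz := Real.exp_pos (-τ)
  have hR0 : 0 ≤ R := div_nonneg (by linarith) h3.le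
  have hT' : (4 : ℝ) ^ k - 1 - 3 ^ k = 3 ^ k * R := by rw [hR]; field_simp
  have h49 : R ≤ 3 ^ k := by
    rw [hR, div_le_iff₀ h3, ← mul_pow]
    have : (4 : ℝ) ^ k ≤ (3 * 3) ^ k := pow_le_pow_left₀ (by norm_num) (by norm_num) k
    linarith
  -- Since `3 ≤ 3^k` and `R ≤ 3^k`, `hτ` gives `e^{-τ} ≤ 1/6` and `R e^{-τ} ≤ 1/2`.
  have key := exp_neg_add_mul_exp_le hR0 (τ := τ) (by nlinarith) (by nlinarith)
  have e1 : Real.exp (-((1 + R / 3) * τ)) = Real.exp (-τ) * Real.exp (-(R * τ / 3)) := by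
    rw [← Real.exp_add]; congr 1; ring
  have e2 : Real.exp (-(2 * τ)) = Real.exp (-τ) * Real.exp (-τ) := by
    rw [← Real.exp_add]; congr 1; ring
  rw [hT', e1, e2]
  calc _ = 3 ^ k * Real.exp (-τ) * (Real.exp (-(R * τ / 3)) + R * Real.exp (-τ)) := by ring
    _ ≤ 3 ^ k * Real.exp (-τ) * 1 := by gcongr
    _ = _ := mul_one _

/-! ### Confidence levels of the two estimators -/

section Experiment

open MeasureTheory

variable {n : ℕ} {η δ : ℝ} {Ω : Type*} [MeasurableSpace Ω] (μ : Measure Ω)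
  [IsProbabilityMeasure μ] {ρ : Matrix (Fin k → Fin 2) (Fin k → Fin 2) ℂ}
  {X : Setting k → Fin n → Ω → Outcome k} {est : Ω → Matrix (Fin k → Fin 2) (Fin k → Fin 2) ℂ}

/-- The budget `8δ²/d` is shared equally among the `d² - 1` labels, which produces the coefficient
`16/(d(d²-1))`. -/
lemma confidence_pauliInverse (hk : 1 ≤ k) (hn : 1 ≤ n) (hη : 0 < η) (hδ : 0 < δ)
    (hρ : IsState ρ) (hX : IsExperiment μ k n η ρ X)
    (hest : ∀ ω, IsENMWith (pauliPOVM k η) (pauliBasis k) (pauliInverse k η)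
      (relFreq fun i q => X i q ω) (est ω)) :
    pauliCL k η δ (3 ^ k * n) ≤ μ.real {ω | traceDist (est ω) ρ ≤ δ} := by
  have h4 : (0 : ℝ) < 4 ^ k - 1 := (by positivity : (0 : ℝ) < 3 ^ k).trans_le (three_pow_le hk)
  have hsq : Real.sqrt (8 * δ ^ 2 / (2 ^ k * (4 ^ k - 1))) ^ 2 =
      8 * δ ^ 2 / (2 ^ k * (4 ^ k - 1)) := Real.sq_sqrt (by positivity)
  refine le_trans (le_of_eq ?_) (confidence_of_thresholds hk hn hδ.le
    (pauliInverse_mul_designMatrix hk hη) μ hρ hX hest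
    (ε := fun _ => Real.sqrt (8 * δ ^ 2 / (2 ^ k * (4 ^ k - 1)))) (fun _ => Real.sqrt_nonneg _) ?_)
  · rw [← confidenceLevel_pauliInverse hk hη, confidenceLevel]
    congr 2
    refine Finset.sum_congr rfl fun β _ => ?_
    rw [hsq, traceDistCoeff, ← pow_mul, mul_comm k 2, pow_mul, show (2 : ℝ) ^ 2 = 4 by norm_num]
    congr 2
    ring
  · simp only [hsq]
    rw [Finset.sum_const, Finset.card_univ, nsmul_eq_mul, card_label]
    apply le_of_eq
    field_simp

/-- Equal thresholds would not give `CL(k)` termwise, as the constants for `l ≥ 1` can be too large.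
Labels with `l ≥ 1` can spare a third of their budget, because their constants are at most a third
of `c₀`; the `l = 0` labels receive it. -/
lemma confidence_lsInverse (hk : 1 ≤ k) (hn : 1 ≤ n) (hη : 0 < η) (hη1 : η ≤ 1) (hδ : 0 < δ)
    (hρ : IsState ρ) (hX : IsExperiment μ k n η ρ X)
    (hest : ∀ ω, IsENMWith (pauliPOVM k η) (pauliBasis k)
      (lsInverse (designMatrix (pauliPOVM k η) (pauliBasis k)))
      (relFreq fun i q => X i q ω) (est ω)) :
    pauliCL k η δ (3 ^ k * n) ≤ μ.real {ω | traceDist (est ω) ρ ≤ δ} := by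
  have h3 : (0 : ℝ) < 3 ^ k := by positivity
  have h4 : (0 : ℝ) < 4 ^ k - 1 := h3.trans_le (three_pow_le hk)
  have hT : (0 : ℝ) ≤ 4 ^ k - 1 - 3 ^ k := by linarith [three_pow_le hk]
  have hn0 : (0 : ℝ) < n := by positivity
  set E : ℝ := 8 * δ ^ 2 / (2 ^ k * (4 ^ k - 1)) with hE
  have hE0 : 0 < E := by positivity
  have hc0 : 0 < pauliConst k η 0 := by unfold pauliConst; positivity
  set τ : ℝ := 2 * E * (3 ^ k * n) / pauliConst k η 0 with hτ
  have hτ0 : 0 < τ := by positivity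
  -- Only the `l = 0` term of `CL(k)` is kept; `τ` is its exponent.
  have hCL : pauliCL k η δ (3 ^ k * n) ≤ 1 - 2 * (3 ^ k * Real.exp (-τ)) := by
    rw [pauliCL]
    gcongr
    refine le_trans (le_of_eq ?_) (Finset.single_le_sum (fun l _ => by positivity)
      (Finset.mem_range.2 (Nat.lt_of_succ_le hk)))
    rw [← pauliExponent_eq hk hη, hτ, hE]
    simp only [Nat.sub_zero, Nat.choose_zero_right, Nat.cast_one, mul_one]
    congr 3
    ring
  -- In the first case `CL(k) ≤ 0` and nothing is claimed.
  rcases le_total 1 (2 * 3 ^ k * Real.exp (-τ)) with htriv | hτ1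
  · exact le_trans (by linarith) measureReal_nonneg
  set R : ℝ := (4 ^ k - 1 - 3 ^ k) / 3 ^ k with hR
  have hR0 : 0 ≤ R := by positivity
  -- `R` is the ratio of the number of labels with `l ≥ 1` to that with `l = 0`, so these shares
  -- still add up to `4^k - 1`.
  let x : Label k → ℝ := fun β => if numId β = 0 then 1 + R / 3 else 2 / 3
  have hx β : 0 ≤ x β := by
    simp only [x]
    split_ifs <;> positivity
  have hsq β : Real.sqrt (x β * E) ^ 2 = x β * E := Real.sq_sqrt (mul_nonneg (hx β) hE0.le)
  refine le_trans ?_ (confidence_of_thresholds hk hn hδ.le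
    (lsInverse_mul (pauliInverse_mul_designMatrix hk hη)) μ hρ hX hest
    (ε := fun β => Real.sqrt (x β * E)) (fun _ => Real.sqrt_nonneg _) ?_)
  · refine hCL.trans ?_
    gcongr
    refine le_trans ?_ (threshold_sum_le hk hτ1)
    rw [← hR, ← sum_label_ite hk]
    refine Finset.sum_le_sum fun β _ => ?_
    have hc := settingConst_lsInverse_le hk hη hη1 β
    have hcpos : 0 < settingConst (fun _ => (3 : ℝ) ^ k)
        (lsInverse (designMatrix (pauliPOVM k η) (pauliBasis k))) β := by
      rw [settingConst_lsInverse hk hη hη1]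
      have := weightSq_pos hη
      have : 0 < max η (2 * (1 - η)) := lt_max_of_lt_left hη
      positivity
    have h1 : x β * 3 ^ numId β * τ ≤ 2 * Real.sqrt (x β * E) ^ 2 * (3 ^ k * n) /
        settingConst (fun _ => (3 : ℝ) ^ k)
          (lsInverse (designMatrix (pauliPOVM k η) (pauliBasis k))) β := by
      rw [hsq]
      refine le_trans (le_of_eq ?_) (div_le_div_of_nonneg_left
        (by have := hx β; positivity) hcpos hc)
      rw [hτ]
      field_simp
    split_ifs with h0
    · rw [Real.exp_le_exp, neg_le_neg_iff]
      refine le_trans (le_of_eq ?_) h1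
      simp [x, h0]
    · rw [Real.exp_le_exp, neg_le_neg_iff]
      refine le_trans ?_ h1
      -- The gain `3^l ≥ 3` outweighs the share `2/3` and leaves the exponent at least `2τ`.
      have : (3 : ℝ) ≤ 3 ^ numId β := le_self_pow₀ (by norm_num) h0
      have hx' : x β = 2 / 3 := if_neg h0
      rw [hx']
      gcongr
      linarith
  · simp only [hsq]
    rw [← Finset.sum_mul, sum_label_ite hk]
    apply le_of_eq
    have : (3 : ℝ) ^ k * (1 + R / 3) + (4 ^ k - 1 - 3 ^ k) * (2 / 3) = 4 ^ k - 1 := by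
      rw [hR]; field_simp; ring
    rw [this, hE]
    field_simp

end Experiment

lemma pauliCL_one (η δ N : ℝ) :
    pauliCL 1 η δ N = 1 - 6 * Real.exp (-(2 / 9 * η ^ 2 * δ ^ 2 * N)) := by
  have e : 2 / (2 ^ (2 * 1) - 1) * (η ^ (2 * (1 - 0)) / 3 ^ (1 - 0)) * δ ^ 2 * N =
      2 / 9 * η ^ 2 * δ ^ 2 * N := by rw [Nat.sub_zero]; ring
  rw [pauliCL, Finset.sum_range_one, e]
  norm_num
  ring

lemma pauliCL_two (η δ N : ℝ) :
    pauliCL 2 η δ N = 1 - 18 * Real.exp (-(2 / 135 * η ^ 4 * δ ^ 2 * N))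
      - 12 * Real.exp (-(2 / 45 * η ^ 2 * δ ^ 2 * N)) := by
  have e0 : 2 / (2 ^ (2 * 2) - 1) * (η ^ (2 * (2 - 0)) / 3 ^ (2 - 0)) * δ ^ 2 * N =
      2 / 135 * η ^ 4 * δ ^ 2 * N := by rw [Nat.sub_zero]; ring
  have e1 : 2 / (2 ^ (2 * 2) - 1) * (η ^ (2 * (2 - 1)) / 3 ^ (2 - 1)) * δ ^ 2 * N =
      2 / 45 * η ^ 2 * δ ^ 2 * N := by rw [show 2 - 1 = 1 from rfl]; ring
  rw [pauliCL, Finset.sum_range_succ, Finset.sum_range_one, e0, e1]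
  norm_num
  ring

end PauliTomography

end

open PauliTomography in
theorem mainTheorem3 (k n N : ℕ) (hk : 1 ≤ k) (hn : 1 ≤ n) (hN : N = 3 ^ k * n)
    (η δ : ℝ) (hη0 : 0 < η) (hη1 : η ≤ 1) (hδ : 0 < δ) :
    -- `B` inverts the measurement model: `s = B (p - a₀)`
    ((∀ σ : Matrix (Fin k → Fin 2) (Fin k → Fin 2) ℂ, σ.IsHermitian → σ.trace = 1 →
        blochVector (pauliBasis k) σ = (pauliInverse k η).mulVec
          (bornProb (pauliPOVM k η) σ - povmOffset (pauliPOVM k η))) ∧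
      pauliInverse k η * designMatrix (pauliPOVM k η) (pauliBasis k) = 1) ∧
    -- the constants `c_α`
    (∀ β : Label k,
      settingConst (fun _ => (N : ℝ) / n) (pauliInverse k η) β = pauliConst k η (numId β)) ∧
    (∀ β : Label k, η = 1 ∨ numId β = 0 →
      settingConst (fun _ => (N : ℝ) / n)
        (lsInverse (designMatrix (pauliPOVM k η) (pauliBasis k))) β =
          pauliConst k η (numId β)) ∧
    -- the closed form of the confidence level for the trace distance
    confidenceLevel (traceDistCoeff (2 ^ k))
      (settingConst (fun _ => (N : ℝ) / n) (pauliInverse k η)) δ N = pauliCL k η δ N ∧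
    (k = 1 → pauliCL k η δ N = 1 - 6 * Real.exp (-(2 / 9 * η ^ 2 * δ ^ 2 * N))) ∧
    (k = 2 → pauliCL k η δ N = 1 - 18 * Real.exp (-(2 / 135 * η ^ 4 * δ ^ 2 * N))
        - 12 * Real.exp (-(2 / 45 * η ^ 2 * δ ^ 2 * N))) ∧
    -- the estimates exist and are unique
    (∀ f : Setting k × Outcome k → ℝ, (∃! σ, IsLLS (pauliPOVM k η) f σ) ∧
      (∃! ρ, IsENM (pauliPOVM k η) f ρ) ∧
      ∃! ρ, IsENMWith (pauliPOVM k η) (pauliBasis k) (pauliInverse k η) f ρ) ∧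
    -- the estimates are within `δ` of the true state with probability at least `CL(k)`
    (∀ (Ω : Type*) [MeasurableSpace Ω] (μ : MeasureTheory.Measure Ω)
      [MeasureTheory.IsProbabilityMeasure μ]
      (ρ : Matrix (Fin k → Fin 2) (Fin k → Fin 2) ℂ) (X : Setting k → Fin n → Ω → Outcome k),
      IsState ρ → IsExperiment μ k n η ρ X →
      ∀ est : Ω → Matrix (Fin k → Fin 2) (Fin k → Fin 2) ℂ,
        ((∀ ω, IsENM (pauliPOVM k η) (relFreq fun i q => X i q ω) (est ω)) ∨
          (∀ ω, IsENMWith (pauliPOVM k η) (pauliBasis k) (pauliInverse k η)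
            (relFreq fun i q => X i q ω) (est ω))) →
        pauliCL k η δ N ≤ μ.real {ω | traceDist (est ω) ρ ≤ δ}) := by
  have hn0 : (n : ℝ) ≠ 0 := by positivity
  have hNn : (N : ℝ) / n = 3 ^ k := by
    rw [hN]
    push_cast
    exact mul_div_cancel_right₀ _ hn0
  have hL := pauliInverse_mul_designMatrix hk hη0
  rw [hNn]
  refine ⟨⟨fun σ hσ htr => blochVector_eq_mulVec hk hL hσ htr, hL⟩,
    settingConst_pauliInverse hk hη0, settingConst_lsInverse_eq hk hη0 hη1,
    confidenceLevel_pauliInverse hk hη0 δ N, ?_, ?_, fun f => ⟨?_, ?_, ?_⟩, ?_⟩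
  · rintro rfl
    exact pauliCL_one η δ N
  · rintro rfl
    exact pauliCL_two η δ N
  · exact ⟨_, (isLLS_iff hk hL f _).2 rfl, fun σ hσ => (isLLS_iff hk hL f σ).1 hσ⟩
  · simp only [isENM_iff hk hL]
    exact existsUnique_isNearestState hk _
  · exact existsUnique_isNearestState hk _
  · intro Ω _ μ _ ρ X hρ hX est hest
    have hN' : (N : ℝ) = 3 ^ k * n := by rw [hN]; push_cast; rfl
    rw [hN']
    rcases hest with h | h
    · exact confidence_lsInverse μ hk hn hη0 hη1 hδ hρ hX
        fun ω => (isENM_iff hk hL _ _).1 (h ω)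
    · exact confidence_pauliInverse μ hk hn hη0 hδ hρ hX h
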